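/- Let $n\ge 3$ and let $A,B\in\mathbb C^{n\times n}$ be such that the pencil $A-\lambda B$ is palindromic ($A^*=B$) or alternating ($A^*=A$, $B^*=-B$), and anti-Hessenberg ($a_{ij}=b_{ij}=0$ whenever $i+j<n$), with $|a_{n-k,k}|+|b_{n-k,k}|>0$ for $k=1,\dots,n-1$. Its poles are $\sigma_k=a_{n-k,k}/b_{n-k,k}\in\mathbb C\cup\{\infty\}$, $k=1,\dots,n-1$ ($\sigma_k$ is the pole in position $k$). For $\rho=\alpha/\beta\in\mathbb C\cup\{\infty\}$ write $A-\rho B$ for $\beta A-\alpha B$, and let $\tilde\rho=1/\overline\rho$ in the palindromic case and $\tilde\rho=-\overline\rho$ in the alternating case. Let $\rho\in\mathbb C\cup\{\infty\}$ be a shift with $\rho\ne\tilde\rho$, and assume that neither $\rho$ nor any of the poles is an eigenvalue of the pencil. A core transformation $Q_j$ is a unitary matrix acting only on rows/columns $j,j+1$. Each of the following moves is a congruence $A-\lambda B\mapsto Q^*(A-\lambda B)Q$ of the current pencil. * Type I with pole $\rho$: $Q$ is a core $Q_{n-1}$ with $Q^*(A-\rho B)e_1=\gamma e_n$, $\gamma\neq0$;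 it places $\rho$ in position $1$ and $\tilde\rho$ in position $n-1$. * Type II at $k$ ($k<n/2$ or $k>n/2+1$): $Q=Z_{k-1}Q_{n-k}$ with cores such that $Q_{n-k}^*(A-\lambda B)Z_{k-1}$ is again anti-Hessenberg with the poles in positions $k-1$ and $k$ interchanged; the congruence also interchanges those in positions $n-k$ and $n-k+1$. If the poles in positions $k-1$ and $k$ are equal, the move is trivial ($Q=I$). * Type IIo ($n$ odd, $k=(n+1)/2$): $Q$ is a core $Q_{k-1}$ that preserves the anti-Hessenberg form and interchanges the two distinct middle poles in positions $k-1$ and $k$. * Type IIe ($n$ even, $k=n/2$): $Q$ is a unitary matrix acting on rows/columns $k-1,k,k+1$ that preserves the anti-Hessenberg form, interchanges the poles in positions $k-1$ and $k+1$, and leaves the one in position $k$ unchanged (the three being distinct). Put $m=\lfloor (n-1)/2\rfloor$. One iteration of the basic algorithm with shift $\rho$ consists of a move of type I with pole $\rho$; moves of type II at $2,3,\dots,m$; a move of type IIo ($n$ odd) or IIe ($n$ even); moves of type II at $m,m-1,\dots,2$; and a move of type I with some new pole $\tau\in\mathbb C\cup\{\infty\}$. Let $Q$ be the product of the transforming matrices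 of these moves. Then the iteration can be carried out for every $\tau$, and however it is carried out, $Q$ is unitary, $\hat A-\lambda\hat B=Q^*(A-\lambda B)Q$ is again anti-Hessenberg with the same structure, and $A-\tilde\rho B$ is invertible. Moreover, with $\mathcal E_k=\mathrm{span}\{e_1,\dots,e_k\}$ and $\mathcal Q_k=Q\mathcal E_k$ (the span of the first $k$ columns of $Q$), $$\mathcal Q_k=(A-\tilde\rho B)^{-1}(A-\rho B)\,\mathcal E_k$$ for $k=1,\dots,n-2$, and also for $k=n-1$ provided that the last move reinstates the original pole, $\tau=\sigma_1$. For all $k=1,\dots,n-1$ the change of coordinates maps $\mathcal Q_k$ back to $\mathcal E_k$, that is, $Q^*\mathcal Q_k=\mathcal E_k$. -/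

import Mathlib

open Matrix

noncomputable section

namespace PoleSwap

/-! ### Poles and shifts in `ℂ ∪ {∞}` -/

/-- The ratio `a / b` in `ℂ ∪ {∞}`, for `(a, b) ≠ (0, 0)`. -/
def ratio (a b : ℂ) : OnePoint ℂ :=
  if b = 0 then OnePoint.infty else ((a / b : ℂ) : OnePoint ℂ)

/-- The numerator `α` of the representation `ρ = α / β` (with `∞ = 1 / 0` and `z = z / 1`). -/
def num (ρ : OnePoint ℂ) : ℂ := ρ.elim 1 (fun z => z)

/-- The denominator `β` of the representation `ρ = α / β`. -/
def den (ρ : OnePoint ℂ) : ℂ := ρ.elim 0 (fun _ => 1)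

/-- The matrix written `A - ρ B`, that is `β A - α B` with `ρ = α / β`.
It is `A - ρ B` for finite `ρ` and `-B` for `ρ = ∞`. -/
def atShift {n : ℕ} (A B : Matrix (Fin n) (Fin n) ℂ) (ρ : OnePoint ℂ) :
    Matrix (Fin n) (Fin n) ℂ :=
  den ρ • A - num ρ • B

/-- `ρ ∈ ℂ ∪ {∞}` is an eigenvalue of the pencil `A - λ B`. -/
def IsEigenvalue {n : ℕ} (A B : Matrix (Fin n) (Fin n) ℂ) (ρ : OnePoint ℂ) : Prop :=
  (atShift A B ρ).det = 0

/-! ### The two structures -/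

/-- The two kinds of structure. -/
inductive Kind where
  | palindromic
  | alternating

/-- Palindromic: `A* = B`.  Alternating: `A* = A` and `B* = -B`. -/
def Kind.Holds (S : Kind) {n : ℕ} (A B : Matrix (Fin n) (Fin n) ℂ) : Prop :=
  match S with
  | Kind.palindromic => Aᴴ = B
  | Kind.alternating => Aᴴ = A ∧ Bᴴ = -B

/-- The companion of `ρ`: it is `1 / ρ̄` in the palindromic case (so that `0` and `∞` are
companions) and `-ρ̄` in the alternating case (so that `∞` is its own companion). -/
def Kind.companion (S : Kind) (ρ : OnePoint ℂ) : OnePoint ℂ :=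
  match S with
  | Kind.palindromic => ratio (star (den ρ)) (star (num ρ))
  | Kind.alternating => ratio (-star (num ρ)) (star (den ρ))

/-! ### Anti-Hessenberg form.  Matrix indices are 0-based, positions of poles are 1-based. -/

/-- Anti-Hessenberg form: in 1-based indices, `m i j = 0` whenever `i + j < n`. -/
def IsAntiHessenberg {n : ℕ} (M : Matrix (Fin n) (Fin n) ℂ) : Prop :=
  ∀ i j : Fin n, (i : ℕ) + (j : ℕ) + 2 < n → M i j = 0

/-- `|a_{n-k,k}| + |b_{n-k,k}| > 0` for `k = 1, …, n-1`. -/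
def IsProper {n : ℕ} (A B : Matrix (Fin n) (Fin n) ℂ) : Prop :=
  ∀ i j : Fin n, (i : ℕ) + (j : ℕ) + 2 = n → 0 < ‖A i j‖ + ‖B i j‖

/-- The pole `σ_k = a_{n-k,k} / b_{n-k,k}`, for `k = 1, …, n-1`
(1-based row `n-k` and column `k`; a dummy value for other `k`). -/
def pole {n : ℕ} (A B : Matrix (Fin n) (Fin n) ℂ) (k : ℕ) : OnePoint ℂ :=
  if h : 1 ≤ k ∧ k < n then
    ratio (A ⟨n - k - 1, by omega⟩ ⟨k - 1, by omega⟩)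
      (B ⟨n - k - 1, by omega⟩ ⟨k - 1, by omega⟩)
  else OnePoint.infty

/-! ### Congruences and core transformations -/

/-- The congruence `M ↦ Q* M Q`. -/
def congruence {n : ℕ} (Q M : Matrix (Fin n) (Fin n) ℂ) : Matrix (Fin n) (Fin n) ℂ :=
  Qᴴ * M * Q

/-- `Q` is unitary and acts only on the rows/columns `lo, …, hi` (1-based). -/
def ActsOn {n : ℕ} (lo hi : ℕ) (Q : Matrix (Fin n) (Fin n) ℂ) : Prop :=
  Q ∈ Matrix.unitaryGroup (Fin n) ℂ ∧
    ∀ i j : Fin n,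
      ¬ ((lo ≤ (i : ℕ) + 1 ∧ (i : ℕ) + 1 ≤ hi) ∧ (lo ≤ (j : ℕ) + 1 ∧ (j : ℕ) + 1 ≤ hi)) →
        Q i j = (1 : Matrix (Fin n) (Fin n) ℂ) i j

/-- A core transformation `Q_j`: a unitary matrix acting on rows/columns `j` and `j+1`. -/
def IsCore {n : ℕ} (j : ℕ) (Q : Matrix (Fin n) (Fin n) ℂ) : Prop :=
  ActsOn j (j + 1) Q

/-! ### The moves.  Each predicate says that the congruence by `Q` performs the given move
on the pencil `A - λ B`. -/

/-- Move of type I inserting the pole `ρ` at position `1`: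
`Q` is a core `Q_{n-1}` with `Q* (A - ρ B) e₁ = γ e_n` for some `γ ≠ 0`. -/
def IsMoveI {n : ℕ} (ρ : OnePoint ℂ) (A B Q : Matrix (Fin n) (Fin n) ℂ) : Prop :=
  IsCore (n - 1) Q ∧
    ∃ γ : ℂ, γ ≠ 0 ∧ ∀ i j : Fin n, (j : ℕ) = 0 →
      (Qᴴ * atShift A B ρ) i j = if (i : ℕ) + 1 = n then γ else 0

/-- Move of type II at `k` (with `k < n/2` or `k > n/2 + 1`): it interchanges the poles in
positions `k-1` and `k`, and with them those in positions `n-k` and `n-k+1`.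
If the poles `σ_{k-1}` and `σ_k` are equal there is nothing to do and `Q = 1`.  Otherwise
`Q = Z_{k-1} W_{n-k}` with cores such that the unitary equivalence `W* (A - λ B) Z` keeps the
anti-Hessenberg form and swaps the two poles. -/
def IsMoveII {n : ℕ} (k : ℕ) (A B Q : Matrix (Fin n) (Fin n) ℂ) : Prop :=
  (2 ≤ k ∧ k + 1 ≤ n ∧ (2 * k < n ∨ n + 2 < 2 * k)) ∧
    ((pole A B (k - 1) = pole A B k ∧ Q = 1) ∨
      (pole A B (k - 1) ≠ pole A B k ∧
        ∃ Z W : Matrix (Fin n) (Fin n) ℂ,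
          IsCore (k - 1) Z ∧ IsCore (n - k) W ∧ Q = Z * W ∧
          IsAntiHessenberg (Wᴴ * A * Z) ∧ IsAntiHessenberg (Wᴴ * B * Z) ∧
          pole (Wᴴ * A * Z) (Wᴴ * B * Z) (k - 1) = pole A B k ∧
          pole (Wᴴ * A * Z) (Wᴴ * B * Z) k = pole A B (k - 1)))

/-- Move of type IIo, for `n = 2 k - 1` odd: a congruence by a core `Q_{k-1}` that keeps the
anti-Hessenberg form and swaps the two (distinct) middle poles `σ_{k-1}` and `σ_k`. -/
def IsMoveIIo {n : ℕ} (A B Q : Matrix (Fin n) (Fin n) ℂ) : Prop :=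
  ∃ k : ℕ, n + 1 = 2 * k ∧
    pole A B (k - 1) ≠ pole A B k ∧
    IsCore (k - 1) Q ∧
    IsAntiHessenberg (congruence Q A) ∧ IsAntiHessenberg (congruence Q B) ∧
    pole (congruence Q A) (congruence Q B) (k - 1) = pole A B k ∧
    pole (congruence Q A) (congruence Q B) k = pole A B (k - 1)

/-- Move of type IIe, for `n = 2 k` even: a congruence by a unitary matrix acting on
rows/columns `k-1, k, k+1` that keeps the anti-Hessenberg form, swaps the poles `σ_{k-1}` and
`σ_{k+1}` and leaves `σ_k` in place (the three poles being distinct). -/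
def IsMoveIIe {n : ℕ} (A B Q : Matrix (Fin n) (Fin n) ℂ) : Prop :=
  ∃ k : ℕ, n = 2 * k ∧
    pole A B (k - 1) ≠ pole A B k ∧ pole A B k ≠ pole A B (k + 1) ∧
    pole A B (k - 1) ≠ pole A B (k + 1) ∧
    ActsOn (k - 1) (k + 1) Q ∧
    IsAntiHessenberg (congruence Q A) ∧ IsAntiHessenberg (congruence Q B) ∧
    pole (congruence Q A) (congruence Q B) (k - 1) = pole A B (k + 1) ∧
    pole (congruence Q A) (congruence Q B) k = pole A B k ∧
    pole (congruence Q A) (congruence Q B) (k + 1) = pole A B (k - 1)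

/-- The names of the moves. -/
inductive Move where
  | I (ρ : OnePoint ℂ)
  | II (k : ℕ)
  | IIo
  | IIe

/-- The congruence by `Q` performs the given move on `A - λ B`. -/
def Move.Performs {n : ℕ} (m : Move) (A B Q : Matrix (Fin n) (Fin n) ℂ) : Prop :=
  match m with
  | Move.I ρ => IsMoveI ρ A B Q
  | Move.II k => IsMoveII k A B Q
  | Move.IIo => IsMoveIIo A B Q
  | Move.IIe => IsMoveIIe A B Q

/-- Performing the moves of the list one after the other, each on the pencil produced by the
previous one, amounts to the congruence by `Q`, the product of the individual transforming
matrices. -/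
def Run {n : ℕ} : List Move → (A B Q : Matrix (Fin n) (Fin n) ℂ) → Prop
  | [], _, _, Q => Q = 1
  | m :: ms, A, B, Q =>
      ∃ Q₁ Q₂ : Matrix (Fin n) (Fin n) ℂ,
        m.Performs A B Q₁ ∧ Run ms (congruence Q₁ A) (congruence Q₁ B) Q₂ ∧ Q = Q₁ * Q₂

/-! ### The basic algorithm and its subspaces -/

/-- One iteration of the basic algorithm in dimension `n` with shift `ρ`, where
`m = ⌊(n-1)/2⌋`: insert `ρ` by a move of type I; push it to the middle by moves of type II at
`2, …, m`; swap the shifts by a move of type IIo (`n` odd) or IIe (`n` even); push them to the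
ends by moves of type II at `m, …, 2`; replace them by a move of type I, which puts the new
pole `τ` at position `1`. -/
def basicIteration (n : ℕ) (ρ τ : OnePoint ℂ) : List Move :=
  [Move.I ρ] ++
  (List.range' 2 ((n - 1) / 2 - 1)).map Move.II ++
  [if n % 2 = 1 then Move.IIo else Move.IIe] ++
  ((List.range' 2 ((n - 1) / 2 - 1)).map Move.II).reverse ++
  [Move.I τ]

/-- `E_k`, the span of the first `k` standard basis vectors. -/
def stdSpan (n k : ℕ) : Submodule ℂ (Fin n → ℂ) :=
  Submodule.span ℂ {v | ∃ j : Fin n, (j : ℕ) < k ∧ v = Pi.single j 1}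

/-- The span of the first `k` columns of `Q`. -/
def colSpan {n : ℕ} (Q : Matrix (Fin n) (Fin n) ℂ) (k : ℕ) : Submodule ℂ (Fin n → ℂ) :=
  Submodule.span ℂ {v | ∃ j : Fin n, (j : ℕ) < k ∧ v = fun i => Q i j}

end PoleSwap

end

open PoleSwap

namespace PoleSwap

/-! Write F_k for the span of the last k standard basis vectors (`botSpan`). Everything rests on one
identity: if σ_k is not an eigenvalue, then (A - σ_k B) E_k = F_k, because the entry defining the
pole is exactly what keeps the image of E_k from lying in F_k (`map_stdSpan_pole`). A swap of the
poles in positions k-1 and k, with 2k < n, changes Q E_j only for j = k-1 among all j < n/2.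
Applying the identity before and after the swap gives (A - σ_k B) Q E_{k-1} = (A - σ_{k-1} B)
E_{k-1} (`IsMoveII.spec`); the middle move gives the analogous relation between ρ and its companion
ρ̃ (`middle_spec`).

Let m = ⌊(n-1)/2⌋. While ρ travels to the middle it leaves (A - σ_{j+1} B) Q E_j = (A - ρB) E_j
behind it for j < m. The middle move gives (A - ρ̃B) Q E_m = (A - ρB) E_m, and the return journey of
ρ̃ turns each σ_{j+1} into ρ̃. `State` records these relations, so the subspace identity follows for
k ≤ m.

The larger k come from duality. The map C = (A - ρ̃B)⁻¹(A - ρB) satisfies C*(A - pB)C = c(A - pB)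
for all p (`Kind.Holds.cayley_conformal`). Put j = n-1-k ≤ m. Anti-Hessenberg form makes E_k
orthogonal to all (A - pB) E_j, and C preserves this. In the new coordinates C E_j is already known
to be E_j, and the vectors orthogonal to all (Â - pB̂) E_j lie in E_k
(`Regular.mem_stdSpan_of_orthogonal`). For k = n-1 the same argument is run with the single form p =
τ = σ_1, for which the first column is a multiple of e_n both before and after the iteration.

The moves exist by kernel-vector constructions on small blocks (`exists_unitary_swap_two`,
`exists_unitary_swap_ends`). Properness survives them because the block determinant, as a function
of the shift, changes only by a nonzero factor (`exists_prod_eq`). -/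

/-! ### Points of ℂ ∪ {∞} as normalised pairs (num, den). -/

theorem den_num_ne_zero (p : OnePoint ℂ) : den p ≠ 0 ∨ num p ≠ 0 := by
  induction p using OnePoint.rec <;> simp [den, num]

theorem cross_ne_zero {p q : OnePoint ℂ} (h : p ≠ q) : den p * num q - num p * den q ≠ 0 := by
  induction p using OnePoint.rec with
  | infty =>
    induction q using OnePoint.rec with
    | infty => exact absurd rfl h
    | coe z => simp [den, num]
  | coe w =>
    induction q using OnePoint.rec with
    | infty => simp [den, num]
    | coe z =>
      have : z - w ≠ 0 := fun h' => h (by rw [sub_eq_zero.1 h'])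
      simpa [den, num] using this

theorem ratio_spec (a b : ℂ) : den (ratio a b) * a - num (ratio a b) * b = 0 := by
  unfold ratio
  split_ifs with h
  · simp [den, h]
  · simp [den, num, h]

/-- A nonzero pair (a, b) determines one point of the projective line. This is how "zero at two
different shifts" becomes "zero in both A and B". -/
theorem eq_of_linear_eq_zero {p q : OnePoint ℂ} {a b : ℂ} (hab : a ≠ 0 ∨ b ≠ 0)
    (hp : den p * a - num p * b = 0) (hq : den q * a - num q * b = 0) : p = q := by
  by_contra h
  have hc := cross_ne_zero h
  have h1 : (den p * num q - num p * den q) * a = 0 := by linear_combination num q * hp - num p * hq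
  have h2 : (den p * num q - num p * den q) * b = 0 := by linear_combination den q * hp - den p * hq
  rcases hab with h' | h'
  · exact (mul_ne_zero hc h') h1
  · exact (mul_ne_zero hc h') h2

theorem ratio_eq_iff {p : OnePoint ℂ} {a b : ℂ} (hab : a ≠ 0 ∨ b ≠ 0) :
    ratio a b = p ↔ den p * a - num p * b = 0 := by
  constructor
  · rintro rfl
    exact ratio_spec a b
  · exact fun h => eq_of_linear_eq_zero hab (ratio_spec a b) h

theorem exists_smul_eq_ratio {a b : ℂ} (hab : a ≠ 0 ∨ b ≠ 0) :
    ∃ c : ℂ, c ≠ 0 ∧ den (ratio a b) * c = b ∧ num (ratio a b) * c = a := by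
  unfold ratio
  split_ifs with h
  · exact ⟨a, by tauto, by simp [den, h], by simp [num]⟩
  · exact ⟨b, h, by simp [den], by simp [num, h]⟩

theorem norm_add_norm_pos_iff {a b : ℂ} : 0 < ‖a‖ + ‖b‖ ↔ a ≠ 0 ∨ b ≠ 0 := by
  constructor
  · intro h
    by_contra h'
    push Not at h'
    simp [h'.1, h'.2] at h
  · rintro (h | h) <;> positivity

/-! ### Structured pencils, their companions and their poles. -/

section Pencil

variable {n : ℕ}

theorem atShift_apply (A B : Matrix (Fin n) (Fin n) ℂ) (p : OnePoint ℂ) (i j : Fin n) :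
    atShift A B p i j = den p * A i j - num p * B i j := by
  simp [atShift]

theorem mul_atShift_mul (A B W Z : Matrix (Fin n) (Fin n) ℂ) (p : OnePoint ℂ) :
    W * atShift A B p * Z = atShift (W * A * Z) (W * B * Z) p := by
  simp [atShift, mul_sub, sub_mul]

theorem congruence_atShift (Q A B : Matrix (Fin n) (Fin n) ℂ) (p : OnePoint ℂ) :
    atShift (congruence Q A) (congruence Q B) p = Qᴴ * atShift A B p * Q :=
  (mul_atShift_mul A B Qᴴ Q p).symm

theorem congruence_mul (P Q M : Matrix (Fin n) (Fin n) ℂ) :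
    congruence (P * Q) M = congruence Q (congruence P M) := by
  simp [congruence, Matrix.mul_assoc]

theorem congruence_one (M : Matrix (Fin n) (Fin n) ℂ) : congruence 1 M = M := by
  simp [congruence]

theorem unitary_conjTranspose_mul {Q : Matrix (Fin n) (Fin n) ℂ}
    (hQ : Q ∈ Matrix.unitaryGroup (Fin n) ℂ) : Qᴴ * Q = 1 :=
  Matrix.mem_unitaryGroup_iff'.1 hQ

theorem unitary_mul_conjTranspose {Q : Matrix (Fin n) (Fin n) ℂ}
    (hQ : Q ∈ Matrix.unitaryGroup (Fin n) ℂ) : Q * Qᴴ = 1 :=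
  Matrix.mem_unitaryGroup_iff.1 hQ

theorem unitary_det_ne_zero {ι : Type*} [Fintype ι] [DecidableEq ι] {Q : Matrix ι ι ℂ}
    (hQ : Q ∈ Matrix.unitaryGroup ι ℂ) : Q.det ≠ 0 := by
  intro h
  have := congrArg det (Matrix.mem_unitaryGroup_iff.1 hQ)
  rw [det_mul, h] at this
  simp at this

theorem isEigenvalue_congruence {Q : Matrix (Fin n) (Fin n) ℂ}
    (hQ : Q ∈ Matrix.unitaryGroup (Fin n) ℂ) (A B : Matrix (Fin n) (Fin n) ℂ) (p : OnePoint ℂ) :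
    IsEigenvalue (congruence Q A) (congruence Q B) p ↔ IsEigenvalue A B p := by
  unfold IsEigenvalue
  have h1 := unitary_det_ne_zero hQ
  rw [congruence_atShift, det_mul, det_mul]
  simp [h1]

theorem Kind.Holds.congruence {S : Kind} {A B : Matrix (Fin n) (Fin n) ℂ} (h : S.Holds A B)
    (Q : Matrix (Fin n) (Fin n) ℂ) : S.Holds (congruence Q A) (congruence Q B) := by
  cases S with
  | palindromic =>
    have h : Aᴴ = B := h
    simp [Kind.Holds, PoleSwap.congruence, conjTranspose_mul, h, Matrix.mul_assoc]
  | alternating =>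
    have h : Aᴴ = A ∧ Bᴴ = -B := h
    simp [Kind.Holds, PoleSwap.congruence, conjTranspose_mul, h.1, h.2, Matrix.mul_assoc]

theorem Kind.Holds.submatrix {S : Kind} {A B : Matrix (Fin n) (Fin n) ℂ} (h : S.Holds A B)
    {r : ℕ} (f : Fin r → Fin n) : S.Holds (A.submatrix f f) (B.submatrix f f) := by
  cases S with
  | palindromic =>
    have h : Aᴴ = B := h
    simp [Kind.Holds, h]
  | alternating =>
    have h : Aᴴ = A ∧ Bᴴ = -B := h
    simp only [Kind.Holds, conjTranspose_submatrix, h.1, h.2, true_and]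
    rfl

/-- The adjoint of a member of the pencil is again a member, at the companion shift. The scalar c is
unavoidable because `num` and `den` are normalised representatives. Both structures enter the later
argument mainly through this relation. -/
theorem Kind.Holds.conjTranspose_atShift {S : Kind} {A B : Matrix (Fin n) (Fin n) ℂ}
    (h : S.Holds A B) (p : OnePoint ℂ) :
    ∃ c : ℂ, c ≠ 0 ∧ (atShift A B p)ᴴ = c • atShift A B (S.companion p) := by
  have hp := den_num_ne_zero p
  cases S with
  | palindromic =>
    have h : Aᴴ = B := h
    obtain ⟨c, hc, h1, h2⟩ := exists_smul_eq_ratio (a := star (den p)) (b := star (num p))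
      (by simpa using hp)
    refine ⟨-c, neg_ne_zero.2 hc, ?_⟩
    have h' : Bᴴ = A := by rw [← h, conjTranspose_conjTranspose]
    simp only [atShift, Kind.companion, conjTranspose_sub, conjTranspose_smul, h, h']
    generalize ratio (star (den p)) (star (num p)) = r at h1 h2
    rw [← h1, ← h2]
    module
  | alternating =>
    have h : Aᴴ = A ∧ Bᴴ = -B := h
    obtain ⟨c, hc, h1, h2⟩ := exists_smul_eq_ratio (a := -star (num p)) (b := star (den p))
      (by simpa [or_comm] using hp)
    refine ⟨c, hc, ?_⟩
    simp only [atShift, Kind.companion, conjTranspose_sub, conjTranspose_smul, h.1, h.2]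
    generalize ratio (-star (num p)) (star (den p)) = r at h1 h2
    have h2' : star (num p) = -(num r * c) := by rw [h2, neg_neg]
    rw [← h1, h2']
    module

theorem Kind.Holds.not_isEigenvalue_companion {S : Kind} {A B : Matrix (Fin n) (Fin n) ℂ}
    (h : S.Holds A B) {p : OnePoint ℂ} (hp : ¬ IsEigenvalue A B p) :
    ¬ IsEigenvalue A B (S.companion p) := by
  obtain ⟨c, hc, hcp⟩ := h.conjTranspose_atShift p
  intro h'
  apply hp
  have := congrArg det hcp
  unfold IsEigenvalue at *
  rw [det_conjTranspose, det_smul, h'] at this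
  simpa using this

/-- Two different shifts give a basis of the pencil, so identities linear in the form need checking
only at p and q; the coefficients are Cramer's rule. -/
theorem exists_eq_add_smul_atShift (A B : Matrix (Fin n) (Fin n) ℂ) {p q : OnePoint ℂ}
    (h : p ≠ q) (r : OnePoint ℂ) :
    ∃ a b : ℂ, atShift A B r = a • atShift A B p + b • atShift A B q := by
  have hc := cross_ne_zero h
  refine ⟨(den r * num q - num r * den q) / (den p * num q - num p * den q),
    (den p * num r - num p * den r) / (den p * num q - num p * den q), ?_⟩
  ext i j
  simp only [atShift_apply, Matrix.add_apply, Matrix.smul_apply, smul_eq_mul]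
  obtain ⟨d, hd⟩ : ∃ d, d = den p * num q - num p * den q := ⟨_, rfl⟩
  rw [← hd] at hc ⊢
  field_simp
  rw [hd]
  ring

theorem eq_zero_of_atShift_apply_eq_zero {A B : Matrix (Fin n) (Fin n) ℂ} {p q : OnePoint ℂ}
    (h : p ≠ q) {i j : Fin n} (hp : atShift A B p i j = 0) (hq : atShift A B q i j = 0) :
    A i j = 0 ∧ B i j = 0 := by
  rw [atShift_apply] at hp hq
  by_contra h'
  exact h (eq_of_linear_eq_zero (by tauto) hp hq)

/-- At a proper entry, the shifted pencil vanishes exactly when the shift is the pole. -/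
theorem pole_eq_iff {A B : Matrix (Fin n) (Fin n) ℂ} {p : OnePoint ℂ}
    {i j : Fin n} (hij : (i : ℕ) + j + 2 = n) (hAB : 0 < ‖A i j‖ + ‖B i j‖) :
    pole A B (j + 1) = p ↔ atShift A B p i j = 0 := by
  have hi : (⟨n - (j + 1) - 1, by omega⟩ : Fin n) = i := Fin.ext (by simp; omega)
  have hj : (⟨j + 1 - 1, by omega⟩ : Fin n) = j := Fin.ext (by simp)
  have h : 1 ≤ (j : ℕ) + 1 ∧ (j : ℕ) + 1 < n := by omega
  rw [pole, dif_pos h, hi, hj, atShift_apply, ratio_eq_iff (norm_add_norm_pos_iff.1 hAB)]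

theorem atShift_pole_apply (A B : Matrix (Fin n) (Fin n) ℂ) {i j : Fin n}
    (hij : (i : ℕ) + j + 2 = n) : atShift A B (pole A B (j + 1)) i j = 0 := by
  have hi : (⟨n - (j + 1) - 1, by omega⟩ : Fin n) = i := Fin.ext (by simp; omega)
  have hj : (⟨j + 1 - 1, by omega⟩ : Fin n) = j := Fin.ext (by simp)
  have h : 1 ≤ (j : ℕ) + 1 ∧ (j : ℕ) + 1 < n := by omega
  rw [pole, dif_pos h, hi, hj, atShift_apply, ratio_spec]

theorem pole_congr {A B A' B' : Matrix (Fin n) (Fin n) ℂ} {i j : Fin n}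
    (hij : (i : ℕ) + j + 2 = n) (hA : A i j = A' i j) (hB : B i j = B' i j) :
    pole A B (j + 1) = pole A' B' (j + 1) := by
  have hi : (⟨n - (j + 1) - 1, by omega⟩ : Fin n) = i := Fin.ext (by simp; omega)
  have hj : (⟨j + 1 - 1, by omega⟩ : Fin n) = j := Fin.ext (by simp)
  have h : 1 ≤ (j : ℕ) + 1 ∧ (j : ℕ) + 1 < n := by omega
  rw [pole, dif_pos h, pole, dif_pos h, hi, hj, hA, hB]

theorem IsAntiHessenberg.atShift {A B : Matrix (Fin n) (Fin n) ℂ} (hA : IsAntiHessenberg A)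
    (hB : IsAntiHessenberg B) (p : OnePoint ℂ) : IsAntiHessenberg (atShift A B p) := by
  intro i j h
  rw [atShift_apply, hA i j h, hB i j h]
  simp

/-- Structured proper anti-Hessenberg pencils. -/
structure Regular (S : Kind) (A B : Matrix (Fin n) (Fin n) ℂ) : Prop where
  holds : S.Holds A B
  left : IsAntiHessenberg A
  right : IsAntiHessenberg B
  proper : IsProper A B

/-- A - σ_j B vanishes at its pole entry, so its adjoint, a multiple of the form at the companion
shift, vanishes at the transposed entry. That entry carries the pole in position n-j. -/
theorem Regular.pole_companion {S : Kind} {A B : Matrix (Fin n) (Fin n) ℂ} (h : Regular S A B)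
    {j k : ℕ} (hj : 1 ≤ j) (hk : 1 ≤ k) (hjk : j + k = n) :
    pole A B k = S.companion (pole A B j) := by
  obtain ⟨i', rfl⟩ : ∃ i', j = i' + 1 := ⟨j - 1, by omega⟩
  obtain ⟨l', rfl⟩ : ∃ l', k = l' + 1 := ⟨k - 1, by omega⟩
  obtain ⟨c, hc, hcp⟩ := h.holds.conjTranspose_atShift (pole A B (i' + 1))
  let i : Fin n := ⟨i', by omega⟩
  let l : Fin n := ⟨l', by omega⟩
  have h0 := atShift_pole_apply A B (i := l) (j := i) (by simp [i, l]; omega)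
  have hil : (i : ℕ) + l + 2 = n := by simp [i, l]; omega
  refine (pole_eq_iff (i := i) (j := l) hil (h.proper i l hil)).2 ?_
  have := congrFun (congrFun hcp i) l
  rw [conjTranspose_apply, h0, Matrix.smul_apply, smul_eq_mul, star_zero] at this
  exact (mul_eq_zero.1 this.symm).resolve_left hc

/-- For structured pencils, properness at an entry passes to the transposed entry. -/
theorem Kind.Holds.proper_symm {S : Kind} {A B : Matrix (Fin n) (Fin n) ℂ}
    (h : S.Holds A B) {i j : Fin n} (hij : 0 < ‖A i j‖ + ‖B i j‖) :
    0 < ‖A j i‖ + ‖B j i‖ := by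
  cases S with
  | palindromic =>
    have h : Aᴴ = B := h
    subst h
    simpa [conjTranspose_apply, add_comm] using hij
  | alternating =>
    have h : Aᴴ = A ∧ Bᴴ = -B := h
    have h1 : A j i = star (A i j) := by conv_lhs => rw [← h.1, conjTranspose_apply]
    have h2 : B j i = -star (B i j) := by
      have := congrFun (congrFun h.2 j) i
      rw [conjTranspose_apply, neg_apply] at this
      rw [this, neg_neg]
    simpa [h1, h2] using hij

theorem Kind.Holds.zero_symm {S : Kind} {A B : Matrix (Fin n) (Fin n) ℂ}
    (h : S.Holds A B) {i j : Fin n} (hij : A i j = 0 ∧ B i j = 0) :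
    A j i = 0 ∧ B j i = 0 := by
  by_contra h'
  have := norm_add_norm_pos_iff.1 (h.proper_symm (norm_add_norm_pos_iff.2 (not_and_or.1 h')))
  tauto

end Pencil

/-! ### The flags E_k and F_k, and anti-Hessenberg form in terms of them. -/

section Flags

variable {n : ℕ}

theorem mem_stdSpan {k : ℕ} {v : Fin n → ℂ} :
    v ∈ stdSpan n k ↔ ∀ i : Fin n, k ≤ (i : ℕ) → v i = 0 := by
  constructor
  · intro h i hi
    refine Submodule.span_induction (p := fun x _ => x i = 0) ?_ rfl ?_ ?_ h
    · rintro _ ⟨j, hj, rfl⟩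
      exact Pi.single_eq_of_ne (fun h => by subst h; omega) _
    · intro x y _ _ hx hy
      simp [hx, hy]
    · intro a x _ hx
      simp [hx]
  · intro h
    rw [pi_eq_sum_univ' v]
    refine Submodule.sum_mem _ fun i _ => ?_
    by_cases hi : k ≤ (i : ℕ)
    · simp [h i hi]
    · refine Submodule.smul_mem _ _ (Submodule.subset_span ⟨i, by omega, ?_⟩)
      ext j
      simp [Pi.single_apply, eq_comm]

/-- The span of the last `k` standard basis vectors. -/
def botSpan (n k : ℕ) : Submodule ℂ (Fin n → ℂ) where
  carrier := {v | ∀ i : Fin n, (i : ℕ) + k < n → v i = 0}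
  zero_mem' := fun _ _ => rfl
  add_mem' := fun hx hy i hi => by simp [hx i hi, hy i hi]
  smul_mem' := fun a x hx i hi => by simp [hx i hi]

theorem mem_botSpan {k : ℕ} {v : Fin n → ℂ} :
    v ∈ botSpan n k ↔ ∀ i : Fin n, (i : ℕ) + k < n → v i = 0 := Iff.rfl

theorem finrank_botSpan (n k : ℕ) :
    Module.finrank ℂ (botSpan n k) = Module.finrank ℂ (stdSpan n k) := by
  have : botSpan n k =
      (stdSpan n k).map (LinearEquiv.funCongrLeft ℂ ℂ (Fin.revPerm (n := n))).toLinearMap := by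
    ext v
    simp only [Submodule.mem_map, LinearEquiv.coe_coe, mem_botSpan]
    constructor
    · intro h
      refine ⟨LinearEquiv.funCongrLeft ℂ ℂ (Fin.revPerm (n := n)) v, ?_, ?_⟩
      · rw [mem_stdSpan]
        intro i hi
        refine h _ ?_
        have := i.2
        simp [Fin.val_rev]
        omega
      · ext i
        simp [LinearEquiv.funCongrLeft_apply, LinearMap.funLeft_apply]
    · rintro ⟨w, hw, rfl⟩ i hi
      rw [mem_stdSpan] at hw
      refine hw _ ?_
      simp [Fin.val_rev]
      omega
  rw [this]
  exact LinearEquiv.finrank_map_eq _ _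

theorem map_mul (M N : Matrix (Fin n) (Fin n) ℂ) (U : Submodule ℂ (Fin n → ℂ)) :
    U.map (M * N).mulVecLin = (U.map N.mulVecLin).map M.mulVecLin := by
  rw [mulVecLin_mul, Submodule.map_comp]

theorem map_one (U : Submodule ℂ (Fin n → ℂ)) :
    U.map (1 : Matrix (Fin n) (Fin n) ℂ).mulVecLin = U := by
  rw [mulVecLin_one, Submodule.map_id]

theorem mulVecLin_injective {M : Matrix (Fin n) (Fin n) ℂ} (hM : M.det ≠ 0) :
    Function.Injective M.mulVecLin :=
  Matrix.mulVec_injective_of_isUnit ((isUnit_iff_isUnit_det _).2 (isUnit_iff_ne_zero.2 hM))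

theorem finrank_map {M : Matrix (Fin n) (Fin n) ℂ} (hM : M.det ≠ 0)
    (U : Submodule ℂ (Fin n → ℂ)) :
    Module.finrank ℂ (U.map M.mulVecLin) = Module.finrank ℂ U :=
  ((Submodule.equivMapOfInjective _ (mulVecLin_injective hM) U).finrank_eq).symm

theorem map_cancel {M : Matrix (Fin n) (Fin n) ℂ} (hM : M.det ≠ 0)
    {U V : Submodule ℂ (Fin n → ℂ)} (h : U.map M.mulVecLin = V.map M.mulVecLin) : U = V :=
  Submodule.map_injective_of_injective (mulVecLin_injective hM) h

theorem map_stdSpan_eq_of_le {M N : Matrix (Fin n) (Fin n) ℂ} (hM : M.det ≠ 0) (hN : N.det ≠ 0)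
    {k : ℕ} (h : (stdSpan n k).map M.mulVecLin ≤ (stdSpan n k).map N.mulVecLin) :
    (stdSpan n k).map M.mulVecLin = (stdSpan n k).map N.mulVecLin :=
  Submodule.eq_of_le_of_finrank_eq h (by rw [finrank_map hM, finrank_map hN])

theorem map_stdSpan_eq_botSpan {M : Matrix (Fin n) (Fin n) ℂ} (hM : M.det ≠ 0)
    {k : ℕ} (h : (stdSpan n k).map M.mulVecLin ≤ botSpan n k) :
    (stdSpan n k).map M.mulVecLin = botSpan n k :=
  Submodule.eq_of_le_of_finrank_eq h (by rw [finrank_map hM, finrank_botSpan])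

theorem single_mem_stdSpan {k : ℕ} {j : Fin n} (h : (j : ℕ) < k) :
    (Pi.single j 1 : Fin n → ℂ) ∈ stdSpan n k :=
  Submodule.subset_span ⟨j, h, rfl⟩

theorem map_stdSpan_le_botSpan_iff {M : Matrix (Fin n) (Fin n) ℂ} {k l : ℕ} :
    (stdSpan n k).map M.mulVecLin ≤ botSpan n l ↔
      ∀ i j : Fin n, (i : ℕ) + l < n → (j : ℕ) < k → M i j = 0 := by
  constructor
  · intro h i j hi hj
    have := h (Submodule.mem_map_of_mem (single_mem_stdSpan hj)) i hi
    simpa using this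
  · rintro h _ ⟨v, hv, rfl⟩ i hi
    rw [SetLike.mem_coe, mem_stdSpan] at hv
    simp only [mulVecLin_apply, mulVec, dotProduct]
    refine Finset.sum_eq_zero fun j _ => ?_
    by_cases hj : (j : ℕ) < k
    · rw [h i j hi hj, zero_mul]
    · rw [hv j (by omega), mul_zero]

/-- The coordinate-free form of the zero pattern: it can be carried through any unitary factor that
preserves the relevant flag members. -/
theorem isAntiHessenberg_iff {M : Matrix (Fin n) (Fin n) ℂ} :
    IsAntiHessenberg M ↔ ∀ j, (stdSpan n j).map M.mulVecLin ≤ botSpan n (j + 1) := by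
  simp only [map_stdSpan_le_botSpan_iff]
  constructor
  · intro h k i j hi hj
    exact h i j (by omega)
  · intro h i j hij
    exact h (j + 1) i j (by omega) (by omega)

theorem map_stdSpan_le_botSpan_of_apply {M : Matrix (Fin n) (Fin n) ℂ} (hM : IsAntiHessenberg M)
    {i j : Fin n} (hij : (i : ℕ) + j + 2 = n) (h : M i j = 0) :
    (stdSpan n (j + 1)).map M.mulVecLin ≤ botSpan n (j + 1) := by
  rw [map_stdSpan_le_botSpan_iff]
  intro i' j' hi hj
  by_cases hlt : (i' : ℕ) + j' + 2 < n
  · exact hM _ _ hlt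
  · obtain rfl : i' = i := Fin.ext (by omega)
    obtain rfl : j' = j := Fin.ext (by omega)
    exact h

/-- At its own pole the shifted matrix has one more zero on the pole antidiagonal, which gives the
inclusion in F_k; regularity at the pole makes the dimensions agree. -/
theorem map_stdSpan_pole {A B : Matrix (Fin n) (Fin n) ℂ} (hA : IsAntiHessenberg A)
    (hB : IsAntiHessenberg B) {k : ℕ} (hk : 1 ≤ k) (hkn : k < n)
    (hp : ¬ IsEigenvalue A B (pole A B k)) :
    (stdSpan n k).map (atShift A B (pole A B k)).mulVecLin = botSpan n k := by
  obtain ⟨j, rfl⟩ : ∃ j : Fin n, k = j + 1 :=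
    ⟨⟨k - 1, by omega⟩, (Nat.sub_add_cancel hk).symm⟩
  obtain ⟨i, hij⟩ : ∃ i : Fin n, (i : ℕ) + j + 2 = n :=
    ⟨⟨n - j - 2, by omega⟩, by rw [Fin.val_mk]; omega⟩
  exact map_stdSpan_eq_botSpan hp
    (map_stdSpan_le_botSpan_of_apply (hA.atShift hB _) hij (atShift_pole_apply A B hij))

theorem colSpan_eq (Q : Matrix (Fin n) (Fin n) ℂ) (k : ℕ) :
    colSpan Q k = (stdSpan n k).map Q.mulVecLin := by
  rw [stdSpan, Submodule.map_span, colSpan]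
  congr 1
  ext v
  simp only [Set.mem_ofPred_eq, Set.mem_image]
  constructor
  · rintro ⟨j, hj, rfl⟩
    exact ⟨_, ⟨j, hj, rfl⟩, by ext i; simp⟩
  · rintro ⟨_, ⟨j, hj, rfl⟩, rfl⟩
    exact ⟨j, hj, by ext i; simp⟩

end Flags

/-! ### Unitary matrices acting on a window of indices. -/

section ActsOn

variable {n : ℕ}

theorem ActsOn.conjTranspose {lo hi : ℕ} {Q : Matrix (Fin n) (Fin n) ℂ} (h : ActsOn lo hi Q) :
    ActsOn lo hi Qᴴ := by
  refine ⟨?_, fun i j hij => ?_⟩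
  · rw [mem_unitaryGroup_iff, star_eq_conjTranspose, conjTranspose_conjTranspose]
    exact unitary_conjTranspose_mul h.1
  · rw [conjTranspose_apply, h.2 j i (by tauto), one_apply, one_apply]
    by_cases hji : j = i
    · simp [hji]
    · simp [hji, Ne.symm hji]

theorem ActsOn.apply_col {lo hi : ℕ} {Q : Matrix (Fin n) (Fin n) ℂ} (h : ActsOn lo hi Q)
    {j : Fin n} (hj : (j : ℕ) + 1 < lo ∨ hi < (j : ℕ) + 1) (i : Fin n) :
    Q i j = (1 : Matrix (Fin n) (Fin n) ℂ) i j :=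
  h.2 i j (by omega)

theorem ActsOn.map_stdSpan {lo hi : ℕ} {Q : Matrix (Fin n) (Fin n) ℂ} (h : ActsOn lo hi Q)
    {k : ℕ} (hk : k < lo ∨ hi ≤ k) : (stdSpan n k).map Q.mulVecLin = stdSpan n k := by
  conv_rhs => rw [← map_one (stdSpan n k)]
  refine map_stdSpan_eq_of_le (unitary_det_ne_zero h.1) (by simp) ?_
  rw [map_one]
  rintro _ ⟨v, hv, rfl⟩
  rw [SetLike.mem_coe, mem_stdSpan] at hv
  rw [mem_stdSpan]
  intro i hi
  simp only [mulVecLin_apply, mulVec, dotProduct]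
  refine Finset.sum_eq_zero fun j _ => ?_
  by_cases hj : (j : ℕ) < k
  · rw [h.2 i j (by omega), one_apply_ne (fun h => by subst h; omega), zero_mul]
  · rw [hv j (by omega), mul_zero]

theorem ActsOn.map_botSpan {lo hi : ℕ} {Q : Matrix (Fin n) (Fin n) ℂ} (h : ActsOn lo hi Q)
    {k : ℕ} (hk : n < lo + k ∨ hi + k ≤ n) : (botSpan n k).map Q.mulVecLin = botSpan n k := by
  refine Submodule.eq_of_le_of_finrank_eq ?_ (finrank_map (unitary_det_ne_zero h.1) _)
  rintro _ ⟨v, hv, rfl⟩ i hi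
  rw [SetLike.mem_coe, mem_botSpan] at hv
  simp only [mulVecLin_apply, mulVec, dotProduct]
  refine Finset.sum_eq_zero fun j _ => ?_
  by_cases hj : (j : ℕ) + k < n
  · rw [hv j hj, mul_zero]
  · rw [h.2 i j (by omega), one_apply_ne (fun h => by subst h; omega), zero_mul]

theorem conjTranspose_mul_mul_apply (W M Z : Matrix (Fin n) (Fin n) ℂ) (i j : Fin n) :
    (Wᴴ * M * Z) i j = star (fun l => W l i) ⬝ᵥ (M *ᵥ fun l => Z l j) := by
  rw [Matrix.mul_assoc, mul_apply]
  rfl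

theorem conjTranspose_mul_mul_apply_congr {W W' M Z Z' : Matrix (Fin n) (Fin n) ℂ} {i j : Fin n}
    (hW : ∀ l, W l i = W' l i) (hZ : ∀ l, Z l j = Z' l j) :
    (Wᴴ * M * Z) i j = (W'ᴴ * M * Z') i j := by
  simp only [conjTranspose_mul_mul_apply, hW, hZ]

theorem conjTranspose_mul_mul_apply_of_one {W M Z : Matrix (Fin n) (Fin n) ℂ} {i j : Fin n}
    (hW : ∀ l, W l i = (1 : Matrix (Fin n) (Fin n) ℂ) l i)
    (hZ : ∀ l, Z l j = (1 : Matrix (Fin n) (Fin n) ℂ) l j) :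
    (Wᴴ * M * Z) i j = M i j := by
  rw [conjTranspose_mul_mul_apply_congr hW hZ]
  simp

theorem mul_apply_of_col_one {Z W : Matrix (Fin n) (Fin n) ℂ} {j : Fin n}
    (hW : ∀ l, W l j = (1 : Matrix (Fin n) (Fin n) ℂ) l j) (l : Fin n) :
    (Z * W) l j = Z l j := by
  rw [mul_apply]
  simp only [hW]
  rw [← mul_apply, Matrix.mul_one]

theorem ActsOn.mul_apply_of_disjoint {lo hi lo' hi' : ℕ} {Z W : Matrix (Fin n) (Fin n) ℂ}
    (hZ : ActsOn lo hi Z) (hW : ActsOn lo' hi' W) (hd : hi < lo' ∨ hi' < lo) {j : Fin n}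
    (hj : (j : ℕ) + 1 < lo' ∨ hi' < (j : ℕ) + 1) (l : Fin n) :
    (W * Z) l j = Z l j := by
  rw [mul_apply]
  calc ∑ m, W l m * Z m j = ∑ m, (1 : Matrix (Fin n) (Fin n) ℂ) l m * Z m j := by
        refine Finset.sum_congr rfl fun m _ => ?_
        by_cases hm : (m : ℕ) + 1 < lo' ∨ hi' < (m : ℕ) + 1
        · rw [hW.apply_col hm]
        · rw [hZ.2 m j (by omega), one_apply_ne (fun h => by subst h; omega), mul_zero, mul_zero]
    _ = Z l j := by rw [← mul_apply, Matrix.one_mul]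

theorem ActsOn.commute {lo hi lo' hi' : ℕ} {Z W : Matrix (Fin n) (Fin n) ℂ}
    (hZ : ActsOn lo hi Z) (hW : ActsOn lo' hi' W) (hd : hi < lo' ∨ hi' < lo) :
    Z * W = W * Z := by
  ext l j
  by_cases hj : (j : ℕ) + 1 < lo' ∨ hi' < (j : ℕ) + 1
  · rw [hZ.mul_apply_of_disjoint hW hd hj, mul_apply_of_col_one (hW.apply_col hj)]
  · have hj' : (j : ℕ) + 1 < lo ∨ hi < (j : ℕ) + 1 := by omega
    rw [hW.mul_apply_of_disjoint hZ hd.symm hj', mul_apply_of_col_one (hZ.apply_col hj')]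

end ActsOn

/-! ### Restriction to a window and embedding of small unitary matrices. -/

section Blocks

variable {n r o o' : ℕ}

/-- Contiguous indices starting at `o`. -/
def IsBlock (o : ℕ) (f : Fin r → Fin n) : Prop := ∀ a, (f a : ℕ) = o + a

theorem IsBlock.injective {f : Fin r → Fin n} (hf : IsBlock o f) : Function.Injective f := by
  intro a b h
  have h1 := hf a
  have h2 := hf b
  rw [h] at h1
  exact Fin.ext (by omega)

theorem IsBlock.exists_eq {f : Fin r → Fin n} (hf : IsBlock o f) {i : Fin n} (h1 : o ≤ i)
    (h2 : (i : ℕ) < o + r) : ∃ a, f a = i :=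
  ⟨⟨i - o, by omega⟩, Fin.ext (by rw [hf]; simp; omega)⟩

theorem exists_isBlock (h : o + r ≤ n) : ∃ f : Fin r → Fin n, IsBlock o f :=
  ⟨fun a => ⟨o + a, by omega⟩, fun _ => rfl⟩

theorem ActsOn.mul_submatrix {Q : Matrix (Fin n) (Fin n) ℂ} (hQ : ActsOn (o + 1) (o + r) Q)
    {f : Fin r → Fin n} (hf : IsBlock o f) (M : Matrix (Fin n) (Fin n) ℂ) {s : ℕ}
    (g : Fin s → Fin n) :
    (M * Q).submatrix g f = M.submatrix g f * Q.submatrix f f := by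
  ext a b
  simp only [submatrix_apply, mul_apply]
  symm
  refine Fintype.sum_of_injective f hf.injective _ _ (fun i hi => ?_) (fun _ => rfl)
  have hi' : (i : ℕ) < o ∨ o + r ≤ (i : ℕ) := by
    by_contra h
    obtain ⟨a, ha⟩ := hf.exists_eq (i := i) (by omega) (by omega)
    exact hi ⟨a, ha⟩
  have := hf b
  rw [hQ.2 i (f b) (by omega), one_apply_ne (fun h => by subst h; omega), mul_zero]

theorem ActsOn.conjTranspose_mul_mul_submatrix {W Z : Matrix (Fin n) (Fin n) ℂ}
    (hW : ActsOn (o' + 1) (o' + r) W) (hZ : ActsOn (o + 1) (o + r) Z) {f g : Fin r → Fin n}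
    (hf : IsBlock o f) (hg : IsBlock o' g) (M : Matrix (Fin n) (Fin n) ℂ) :
    (Wᴴ * M * Z).submatrix g f =
      (W.submatrix g g)ᴴ * M.submatrix g f * Z.submatrix f f := by
  rw [hZ.mul_submatrix hf]
  congr 1
  have := congrArg Matrix.conjTranspose (hW.mul_submatrix hg Mᴴ f)
  simpa [conjTranspose_submatrix, conjTranspose_mul] using this

theorem ActsOn.submatrix_mem {Q : Matrix (Fin n) (Fin n) ℂ} (hQ : ActsOn (o + 1) (o + r) Q)
    {f : Fin r → Fin n} (hf : IsBlock o f) :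
    Q.submatrix f f ∈ unitaryGroup (Fin r) ℂ := by
  rw [mem_unitaryGroup_iff', star_eq_conjTranspose, conjTranspose_submatrix,
    ← hQ.mul_submatrix hf, unitary_conjTranspose_mul hQ.1, submatrix_one _ hf.injective]

theorem exists_actsOn {f : Fin r → Fin n} (hf : IsBlock o f) {Q : Matrix (Fin r) (Fin r) ℂ}
    (hQ : Q ∈ unitaryGroup (Fin r) ℂ) :
    ∃ U : Matrix (Fin n) (Fin n) ℂ, ActsOn (o + 1) (o + r) U ∧ U.submatrix f f = Q := by
  set P : Matrix (Fin n) (Fin r) ℂ := (1 : Matrix (Fin n) (Fin n) ℂ).submatrix id f with hP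
  have hPH : Pᴴ = (1 : Matrix (Fin n) (Fin n) ℂ).submatrix f id := by
    rw [hP, conjTranspose_submatrix, conjTranspose_one]
  have hPP : Pᴴ * P = 1 := by
    rw [hPH, hP, ← submatrix_mul _ _ f id f Function.bijective_id, Matrix.one_mul,
      submatrix_one _ hf.injective]
  have hQ' : Qᴴ * Q = 1 := mem_unitaryGroup_iff'.1 hQ
  -- P is the isometric inclusion of the window, so this matrix is Q on the window and the identity
  -- off it.
  refine ⟨1 + P * (Q - 1) * Pᴴ, ⟨?_, ?_⟩, ?_⟩
  · rw [mem_unitaryGroup_iff', star_eq_conjTranspose]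
    have : (1 + P * (Q - 1) * Pᴴ)ᴴ * (1 + P * (Q - 1) * Pᴴ) =
        1 + P * ((Q - 1) + (Qᴴ - 1) + (Qᴴ - 1) * (Q - 1)) * Pᴴ := by
      simp only [conjTranspose_add, conjTranspose_one, conjTranspose_mul, conjTranspose_sub,
        conjTranspose_conjTranspose]
      have h : P * ((Qᴴ - 1) * Pᴴ) * (P * (Q - 1) * Pᴴ) = P * ((Qᴴ - 1) * (Q - 1)) * Pᴴ := by
        calc _ = P * ((Qᴴ - 1) * (Pᴴ * P) * (Q - 1)) * Pᴴ := by simp only [Matrix.mul_assoc]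
          _ = _ := by rw [hPP, Matrix.mul_one]
      rw [add_mul, mul_add, mul_add, h, Matrix.one_mul, Matrix.one_mul, Matrix.mul_one,
        Matrix.mul_add, Matrix.mul_add, Matrix.add_mul, Matrix.add_mul,
        ← Matrix.mul_assoc P (Qᴴ - 1) Pᴴ]
      abel
    rw [this]
    have h0 : (Q - 1) + (Qᴴ - 1) + (Qᴴ - 1) * (Q - 1) = 0 := by
      rw [sub_mul, mul_sub, hQ', Matrix.one_mul, Matrix.mul_one]
      abel
    rw [h0, Matrix.mul_zero, Matrix.zero_mul, add_zero]
  · intro i j hij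
    have key : ∀ i : Fin n, ¬ (o ≤ (i : ℕ) ∧ (i : ℕ) < o + r) → ∀ a, P i a = 0 := by
      intro i hi a
      have := hf a
      rw [hP, submatrix_apply, id, one_apply_ne (fun h => by subst h; omega)]
    rw [Matrix.add_apply, add_eq_left]
    by_cases hi : o ≤ (i : ℕ) ∧ (i : ℕ) < o + r
    · rw [mul_apply]
      refine Finset.sum_eq_zero fun a _ => ?_
      rw [conjTranspose_apply, key j (by omega), star_zero, mul_zero]
    · rw [Matrix.mul_assoc, mul_apply]
      refine Finset.sum_eq_zero fun a _ => ?_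
      rw [key i hi, zero_mul]
  · have h1 : ∀ X : Matrix (Fin n) (Fin n) ℂ, X.submatrix f f = Pᴴ * X * P := by
      intro X
      conv_lhs => rw [← Matrix.mul_one X, ← Matrix.one_mul X]
      rw [submatrix_mul _ _ f id f Function.bijective_id,
        submatrix_mul _ _ f id id Function.bijective_id, hPH, hP, submatrix_id_id]
    rw [h1, Matrix.mul_add, Matrix.add_mul, Matrix.mul_one, hPP]
    calc 1 + Pᴴ * (P * (Q - 1) * Pᴴ) * P = 1 + (Pᴴ * P) * (Q - 1) * (Pᴴ * P) := by
          simp only [Matrix.mul_assoc]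
      _ = Q := by rw [hPP, Matrix.one_mul, Matrix.mul_one, add_sub_cancel]

/-- Normalise the vectors prescribed on s and extend them to an orthonormal basis. The scalars c are
the inverse norms. -/
theorem exists_unitary_of_orthogonal {ι : Type*} [Fintype ι] [DecidableEq ι] (s : Set ι)
    (v : ι → ι → ℂ) (hv : ∀ a ∈ s, v a ≠ 0)
    (ho : ∀ a ∈ s, ∀ b ∈ s, a ≠ b → star (v a) ⬝ᵥ v b = 0) :
    ∃ Q ∈ unitaryGroup ι ℂ, ∃ c : ι → ℂ, (∀ a ∈ s, c a ≠ 0) ∧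
      ∀ a ∈ s, ∀ i, Q i a = c a * v a i := by
  let w : ι → EuclideanSpace ℂ ι := fun a => WithLp.toLp 2 (v a)
  have hw : ∀ a ∈ s, w a ≠ 0 := fun a ha h => hv a ha (by simpa [w] using h)
  let u : ι → EuclideanSpace ℂ ι := fun a => ((‖w a‖ : ℂ)⁻¹) • w a
  have hu : Orthonormal ℂ (s.domRestrict u) := by
    constructor
    · rintro ⟨a, ha⟩
      simp [u, norm_smul, norm_ne_zero_iff.2 (hw a ha)]
    · rintro ⟨a, ha⟩ ⟨b, hb⟩ hab
      have := ho a ha b hb (fun h => hab (by simp [h]))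
      simp only [Set.domRestrict_apply, u, inner_smul_left, inner_smul_right]
      rw [EuclideanSpace.inner_eq_star_dotProduct, dotProduct_comm]
      simp [w, this]
  obtain ⟨b, hb⟩ := hu.exists_orthonormalBasis_extension_of_card_eq (by simp)
  refine ⟨(EuclideanSpace.basisFun ι ℂ).toBasis.toMatrix b,
    OrthonormalBasis.toMatrix_orthonormalBasis_mem_unitary _ _, fun a => ((‖w a‖ : ℂ)⁻¹),
    fun a ha => by simp [hw a ha], fun a ha i => ?_⟩
  rw [Module.Basis.toMatrix_apply, hb a ha]
  simp [u, w]

end Blocks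

/-! ### Existence of the pole swaps on blocks of size two and three. -/

section SmallBlocks

variable {r : ℕ}

theorem mul_apply_col {X Z : Matrix (Fin r) (Fin r) ℂ} {a : Fin r} {c : ℂ} {z : Fin r → ℂ}
    (hZ : ∀ i, Z i a = c * z i) (i : Fin r) : (X * Z) i a = c * (X *ᵥ z) i := by
  simp only [mul_apply, mulVec, dotProduct, hZ, Finset.mul_sum]
  exact Finset.sum_congr rfl fun l _ => by ring

theorem mul_mul_apply_col {X M Z : Matrix (Fin r) (Fin r) ℂ} {a : Fin r} {c : ℂ} {z : Fin r → ℂ}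
    (hZ : ∀ i, Z i a = c * z i) (i : Fin r) :
    (X * M * Z) i a = c * (X *ᵥ (M *ᵥ z)) i := by
  rw [mul_apply_col hZ, mulVec_mulVec]

/-- Take z in the kernel of G - qH as first column of Z. For any p ≠ q the first columns of all
transformed forms are then multiples of W*w, where w = (G - pH)z, and making w the second column of
W clears the top entry. -/
theorem exists_unitary_swap_two {G H : Matrix (Fin 2) (Fin 2) ℂ} (hG : G 0 0 = 0) (hH : H 0 0 = 0)
    {q : OnePoint ℂ} (hq : atShift G H q 0 1 = 0) :
    ∃ W ∈ unitaryGroup (Fin 2) ℂ, ∃ Z ∈ unitaryGroup (Fin 2) ℂ,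
      (Wᴴ * G * Z) 0 0 = 0 ∧ (Wᴴ * H * Z) 0 0 = 0 ∧ atShift (Wᴴ * G * Z) (Wᴴ * H * Z) q 1 0 = 0 := by
  have hdet : (atShift G H q).det = 0 := by
    rw [det_fin_two, hq, atShift_apply, hG, hH]
    simp
  obtain ⟨z, hz, hCz⟩ := exists_mulVec_eq_zero_iff.2 hdet
  obtain ⟨p, hp⟩ := exists_ne q
  set w := atShift G H p *ᵥ z with hw
  obtain ⟨Z, hZ, c, -, hZc⟩ := exists_unitary_of_orthogonal {(0 : Fin 2)} (fun _ => z)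
    (by simpa using hz) (by simp)
  obtain ⟨W, hW, hWw⟩ : ∃ W ∈ unitaryGroup (Fin 2) ℂ, (Wᴴ *ᵥ w) 0 = 0 := by
    by_cases h0 : w = 0
    · exact ⟨1, one_mem _, by simp [h0]⟩
    · obtain ⟨W, hW, d, hd, hWd⟩ := exists_unitary_of_orthogonal {(1 : Fin 2)} (fun _ => w)
        (by simpa using h0) (by simp)
      refine ⟨W, hW, ?_⟩
      have h01 := congrFun (congrFun (mem_unitaryGroup_iff'.1 hW) 0) 1
      rw [mul_apply_col (hWd 1 rfl), one_apply_ne (by decide)] at h01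
      exact (mul_eq_zero.1 h01).resolve_left (hd 1 rfl)
  have hC : ∀ i, (Wᴴ * atShift G H q * Z) i 0 = 0 := fun i => by
    rw [mul_mul_apply_col (hZc 0 rfl), hCz]
    simp
  have hD : (Wᴴ * atShift G H p * Z) 0 0 = 0 := by
    rw [mul_mul_apply_col (hZc 0 rfl), ← hw, hWw, mul_zero]
  have h1 := hC 0
  rw [mul_atShift_mul] at h1 hD
  obtain ⟨h2, h3⟩ := eq_zero_of_atShift_apply_eq_zero hp hD h1
  exact ⟨W, hW, Z, hZ, h2, h3, by rw [← mul_atShift_mul]; exact hC 1⟩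

/-- A congruence leaves only one unitary matrix to choose, so the kernel vector z of G - qH and w =
(G - q̃H)z must both be columns of it. This is possible because G - q̃H is proportional to (G -
qH)*, whence z*w = 0. The zeros in the row come from those in the column by structure. -/
theorem exists_unitary_swap_ends {S : Kind} {G H : Matrix (Fin r) (Fin r) ℂ} (hS : S.Holds G H)
    {i₀ i₁ : Fin r} (h01 : i₀ ≠ i₁) {q : OnePoint ℂ} (hq : q ≠ S.companion q)
    (hdet : (atShift G H q).det = 0) :
    ∃ Q ∈ unitaryGroup (Fin r) ℂ,
      (∀ i, i ≠ i₁ → (Qᴴ * G * Q) i i₀ = 0 ∧ (Qᴴ * H * Q) i i₀ = 0) ∧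
      (∀ i, i ≠ i₁ → (Qᴴ * G * Q) i₀ i = 0 ∧ (Qᴴ * H * Q) i₀ i = 0) ∧
      atShift (Qᴴ * G * Q) (Qᴴ * H * Q) q i₁ i₀ = 0 := by
  obtain ⟨z, hz, hCz⟩ := exists_mulVec_eq_zero_iff.2 hdet
  set w := atShift G H (S.companion q) *ᵥ z with hw
  have hzw : star z ⬝ᵥ w = 0 := by
    obtain ⟨c, hc, hcp⟩ := hS.conjTranspose_atShift q
    have h1 : star z ⬝ᵥ ((atShift G H q)ᴴ *ᵥ z) = 0 := by
      rw [dotProduct_mulVec, vecMul_conjTranspose, star_star, hCz]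
      simp
    rw [hcp, smul_mulVec, dotProduct_smul, ← hw] at h1
    exact (smul_eq_zero.1 h1).resolve_left hc
  obtain ⟨Q, hQ, c, hc0, hcol, hQw⟩ : ∃ Q ∈ unitaryGroup (Fin r) ℂ, ∃ c : ℂ, c ≠ 0 ∧
      (∀ i, Q i i₀ = c * z i) ∧ ∀ i, i ≠ i₁ → (Qᴴ *ᵥ w) i = 0 := by
    -- If w = 0 the condition on Q*w is empty and only the column z has to be prescribed.
    by_cases h0 : w = 0
    · obtain ⟨Q, hQ, c, hc, hQc⟩ := exists_unitary_of_orthogonal {i₀} (fun _ => z)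
        (by simpa using hz) (by simp)
      exact ⟨Q, hQ, c i₀, hc i₀ rfl, hQc i₀ rfl, by simp [h0]⟩
    · have hwz : star w ⬝ᵥ z = 0 := by
        rw [star_dotProduct, hzw, star_zero]
      obtain ⟨Q, hQ, c, hc, hQc⟩ := exists_unitary_of_orthogonal {i₀, i₁}
        (fun i => if i = i₀ then z else w)
        (by
          rintro a (rfl | rfl)
          · simpa using hz
          · simpa [h01.symm] using h0)
        (by
          rintro a (rfl | rfl) b (rfl | rfl) hab
          · exact absurd rfl hab
          · simpa [h01.symm] using hzw
          · simpa [h01.symm] using hwz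
          · exact absurd rfl hab)
      refine ⟨Q, hQ, c i₀, hc i₀ (by simp), fun i => by simpa using hQc i₀ (by simp) i,
        fun i hi => ?_⟩
      have h1 := congrFun (congrFun (mem_unitaryGroup_iff'.1 hQ) i) i₁
      have hQ1 : ∀ l, Q l i₁ = c i₁ * w l :=
        fun l => by simpa [h01.symm] using hQc i₁ (by simp) l
      rw [mul_apply_col hQ1, one_apply_ne hi] at h1
      exact (mul_eq_zero.1 h1).resolve_left (hc i₁ (by simp))
  have hC : ∀ i, (Qᴴ * atShift G H q * Q) i i₀ = 0 := fun i => by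
    rw [mul_mul_apply_col hcol, hCz]
    simp
  have hD : ∀ i, i ≠ i₁ → (Qᴴ * atShift G H (S.companion q) * Q) i i₀ = 0 := fun i hi => by
    rw [mul_mul_apply_col hcol, ← hw, hQw i hi, mul_zero]
  have hzero : ∀ i, i ≠ i₁ → (Qᴴ * G * Q) i i₀ = 0 ∧ (Qᴴ * H * Q) i i₀ = 0 := fun i hi => by
    have h1 := hC i
    have h2 := hD i hi
    rw [mul_atShift_mul] at h1 h2
    exact eq_zero_of_atShift_apply_eq_zero hq h1 h2
  refine ⟨Q, hQ, hzero, fun i hi => ?_, by rw [← mul_atShift_mul]; exact hC i₁⟩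
  exact (hS.congruence Q).zero_symm (hzero i hi)

theorem det_of_antiTriangular (hr : r = 2 ∨ r = 3) {X : Matrix (Fin r) (Fin r) ℂ}
    (hX : ∀ a b : Fin r, (a : ℕ) + b + 1 < r → X a b = 0) :
    X.det = -∏ b, X b.rev b := by
  rcases hr with rfl | rfl
  · have h : X 0 0 = 0 := hX 0 0 (by decide)
    rw [det_fin_two, h, Fin.prod_univ_two, show Fin.rev (0 : Fin 2) = 1 from rfl,
      show Fin.rev (1 : Fin 2) = 0 from rfl]
    ring
  · have h1 : X 0 0 = 0 := hX 0 0 (by decide)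
    have h2 : X 0 1 = 0 := hX 0 1 (by decide)
    have h3 : X 1 0 = 0 := hX 1 0 (by decide)
    rw [det_fin_three, h1, h2, h3, Fin.prod_univ_three, show Fin.rev (0 : Fin 3) = 2 from rfl,
      show Fin.rev (1 : Fin 3) = 1 from rfl, show Fin.rev (2 : Fin 3) = 0 from rfl]
    ring

end SmallBlocks

/-! ### Conservation of the poles of a block under unitary equivalence. -/

section Blocks

variable {n r o o' : ℕ}

/-- A unitary equivalence keeping a diagonal block of the pencil anti-triangular multiplies the
product of its antidiagonal entries by a nonzero constant. -/
theorem exists_prod_eq (hr : r = 2 ∨ r = 3) (ho : o' + o + r + 1 = n)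
    {A B W Z : Matrix (Fin n) (Fin n) ℂ}
    (hW : ActsOn (o' + 1) (o' + r) W) (hZ : ActsOn (o + 1) (o + r) Z) {f g : Fin r → Fin n}
    (hf : IsBlock o f) (hg : IsBlock o' g)
    (hA : IsAntiHessenberg A) (hB : IsAntiHessenberg B)
    (hA' : IsAntiHessenberg (Wᴴ * A * Z)) (hB' : IsAntiHessenberg (Wᴴ * B * Z)) :
    ∃ c : ℂ, c ≠ 0 ∧ ∀ p, ∏ b, atShift (Wᴴ * A * Z) (Wᴴ * B * Z) p (g b.rev) (f b) =
      c * ∏ b, atShift A B p (g b.rev) (f b) := by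
  have h1 := unitary_det_ne_zero (hW.submatrix_mem hg)
  have h2 := unitary_det_ne_zero (hZ.submatrix_mem hf)
  refine ⟨star (W.submatrix g g).det * (Z.submatrix f f).det,
    mul_ne_zero (star_ne_zero.2 h1) h2, fun p => ?_⟩
  -- Since o' + o + r + 1 = n, the antidiagonal of the block lies on the antidiagonal carrying the
  -- poles, and everything above it vanishes. For r = 2 and r = 3 the reversal permutation is odd,
  -- hence the same sign.
  have tri : ∀ M : Matrix (Fin n) (Fin n) ℂ, IsAntiHessenberg M →
      (M.submatrix g f).det = -∏ b, M (g b.rev) (f b) := fun M hM =>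
    det_of_antiTriangular hr fun a b hab => hM _ _ (by rw [hf, hg]; omega)
  have h3 := tri _ (hA.atShift hB p)
  have h4 := tri _ (hA'.atShift hB' p)
  rw [← mul_atShift_mul, hW.conjTranspose_mul_mul_submatrix hZ hf hg, det_mul, det_mul,
    det_conjTranspose, h3] at h4
  rw [← mul_atShift_mul]
  linear_combination h4

theorem exists_atShift_apply_ne_zero {ι : Type*} [Fintype ι] {A B : Matrix (Fin n) (Fin n) ℂ}
    {u v : ι → Fin n} (h : ∀ b, 0 < ‖A (u b) (v b)‖ + ‖B (u b) (v b)‖) :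
    ∃ p, ∀ b, atShift A B p (u b) (v b) ≠ 0 := by
  classical
  obtain ⟨p, hp⟩ := Infinite.exists_notMem_finset
    (Finset.univ.image fun b => ratio (A (u b) (v b)) (B (u b) (v b)))
  refine ⟨p, fun b hb => hp ?_⟩
  rw [atShift_apply] at hb
  rw [Finset.mem_image]
  exact ⟨b, Finset.mem_univ _, (ratio_eq_iff (norm_add_norm_pos_iff.1 (h b))).2 hb⟩

theorem proper_of_atShift_apply_ne_zero {A B : Matrix (Fin n) (Fin n) ℂ} {p : OnePoint ℂ}
    {i j : Fin n} (h : atShift A B p i j ≠ 0) : 0 < ‖A i j‖ + ‖B i j‖ := by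
  rw [norm_add_norm_pos_iff]
  by_contra h'
  push Not at h'
  exact h (by rw [atShift_apply, h'.1, h'.2]; simp)

/-- At a shift avoiding the finitely many old poles the old product is nonzero, hence so is the new
one and each of its factors. This must precede any conclusion about new poles, since `ratio 0 0` is
the dummy value ∞. -/
theorem block_proper {A B A' B' : Matrix (Fin n) (Fin n) ℂ} {u v : Fin r → Fin n}
    (hAB : ∀ b, 0 < ‖A (u b) (v b)‖ + ‖B (u b) (v b)‖)
    (h : ∃ c : ℂ, c ≠ 0 ∧ ∀ p, ∏ b, atShift A' B' p (u b) (v b) =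
      c * ∏ b, atShift A B p (u b) (v b)) (b : Fin r) :
    0 < ‖A' (u b) (v b)‖ + ‖B' (u b) (v b)‖ := by
  obtain ⟨c, hc, h⟩ := h
  obtain ⟨p, hp⟩ := exists_atShift_apply_ne_zero hAB
  have h1 := mul_ne_zero hc (Finset.prod_ne_zero_iff.2 fun b (_ : b ∈ Finset.univ) => hp b)
  rw [← h p] at h1
  exact proper_of_atShift_apply_ne_zero (Finset.prod_ne_zero_iff.1 h1 b (Finset.mem_univ _))

/-- An old pole is a root of the new product; if all other slots are excluded, it sits in the one
left over. -/
theorem block_remaining {A B A' B' : Matrix (Fin n) (Fin n) ℂ} {u v : Fin r → Fin n}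
    (h : ∃ c : ℂ, c ≠ 0 ∧ ∀ p, ∏ b, atShift A' B' p (u b) (v b) =
      c * ∏ b, atShift A B p (u b) (v b)) {p : OnePoint ℂ} {b₀ b₁ : Fin r}
    (h1 : atShift A B p (u b₁) (v b₁) = 0)
    (h0 : ∀ b, b ≠ b₀ → atShift A' B' p (u b) (v b) ≠ 0) :
    atShift A' B' p (u b₀) (v b₀) = 0 := by
  obtain ⟨c, hc, h⟩ := h
  have h2 : ∏ b, atShift A B p (u b) (v b) = 0 := Finset.prod_eq_zero (Finset.mem_univ b₁) h1
  have h2 := (h p).trans (by rw [h2, mul_zero])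
  obtain ⟨b, -, hb⟩ := Finset.prod_eq_zero_iff.1 h2
  by_cases hb0 : b = b₀
  · rwa [hb0] at hb
  · exact absurd hb (h0 b hb0)

/-- Flag members that do not cut the window are preserved, so only zeros inside the block can be
endangered. -/
theorem isAntiHessenberg_of_block (ho : o' + o + r + 1 = n) {M W Z : Matrix (Fin n) (Fin n) ℂ}
    (hW : ActsOn (o' + 1) (o' + r) W) (hZ : ActsOn (o + 1) (o + r) Z) {f g : Fin r → Fin n}
    (hf : IsBlock o f) (hg : IsBlock o' g) (hM : IsAntiHessenberg M)
    (h : ∀ a b : Fin r, (a : ℕ) + b + 1 < r → (Wᴴ * M * Z) (g a) (f b) = 0) :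
    IsAntiHessenberg (Wᴴ * M * Z) := by
  have key : ∀ l, (l ≤ o ∨ o + r ≤ l) →
      (stdSpan n l).map (Wᴴ * M * Z).mulVecLin ≤ botSpan n (l + 1) := by
    intro l hl
    rw [map_mul, hZ.map_stdSpan (by omega), map_mul,
      ← hW.conjTranspose.map_botSpan (k := l + 1) (by omega)]
    exact Submodule.map_mono (isAntiHessenberg_iff.1 hM l)
  intro i j hij
  by_cases hj : (j : ℕ) < o ∨ o + r ≤ (j : ℕ)
  · exact map_stdSpan_le_botSpan_iff.1 (key (j + 1) (by omega)) i j (by omega) (by omega)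
  · by_cases hi : (i : ℕ) < o'
    · exact map_stdSpan_le_botSpan_iff.1 (key (o + r) (by omega)) i j (by omega) (by omega)
    · obtain ⟨b, rfl⟩ := hf.exists_eq (i := j) (by omega) (by omega)
      obtain ⟨a, rfl⟩ := hg.exists_eq (i := i) (by omega) (by omega)
      rw [hf, hg] at hij
      exact h a b (by omega)

end Blocks

/-! ### Existence and effect of the individual moves. -/

section Moves

variable {n r o o' : ℕ} {S : Kind} {A B : Matrix (Fin n) (Fin n) ℂ}

theorem Regular.pole_eq_iff (h : Regular S A B) {p : OnePoint ℂ} {i j : Fin n}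
    (hij : (i : ℕ) + j + 2 = n) : pole A B (j + 1) = p ↔ atShift A B p i j = 0 :=
  PoleSwap.pole_eq_iff hij (h.proper i j hij)

/-- This is the identity (A - σ_k B) E_k = F_k for the transformed pencil, pulled back to the
original one; W disappears because it fixes F_k. -/
theorem map_swapped {W Z : Matrix (Fin n) (Fin n) ℂ} (hW : W ∈ unitaryGroup (Fin n) ℂ)
    (hZ : Z ∈ unitaryGroup (Fin n) ℂ) (hA : IsAntiHessenberg (Wᴴ * A * Z))
    (hB : IsAntiHessenberg (Wᴴ * B * Z)) {k : ℕ} (hk : 1 ≤ k) (hkn : k < n)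
    (hp : ¬ IsEigenvalue A B (pole (Wᴴ * A * Z) (Wᴴ * B * Z) k))
    (hWk : (botSpan n k).map W.mulVecLin = botSpan n k) :
    ((stdSpan n k).map Z.mulVecLin).map
      (atShift A B (pole (Wᴴ * A * Z) (Wᴴ * B * Z) k)).mulVecLin = botSpan n k := by
  have h1 : ¬ IsEigenvalue (Wᴴ * A * Z) (Wᴴ * B * Z) (pole (Wᴴ * A * Z) (Wᴴ * B * Z) k) := by
    unfold IsEigenvalue at *
    rw [← mul_atShift_mul, det_mul, det_mul, det_conjTranspose]
    exact mul_ne_zero (mul_ne_zero (star_ne_zero.2 (unitary_det_ne_zero hW)) hp)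
      (unitary_det_ne_zero hZ)
  have h2 := map_stdSpan_pole hA hB hk hkn h1
  rw [← mul_atShift_mul] at h2
  have h3 := congrArg (Submodule.map W.mulVecLin) h2
  rw [hWk, ← map_mul, ← Matrix.mul_assoc, ← Matrix.mul_assoc, unitary_mul_conjTranspose hW,
    Matrix.one_mul, map_mul] at h3
  exact h3

/-! ### Moves of type I -/

theorem ActsOn.conjTranspose_mul_submatrix {W : Matrix (Fin n) (Fin n) ℂ}
    (hW : ActsOn (o + 1) (o + r) W) {g : Fin r → Fin n} (hg : IsBlock o g)
    (M : Matrix (Fin n) (Fin n) ℂ) {s : ℕ} (f : Fin s → Fin n) :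
    (Wᴴ * M).submatrix g f = (W.submatrix g g)ᴴ * M.submatrix g f := by
  have := congrArg Matrix.conjTranspose (hW.mul_submatrix hg Mᴴ f)
  simpa [conjTranspose_submatrix, conjTranspose_mul] using this

theorem exists_moveI (hn : 3 ≤ n) (h : Regular S A B) (hp : ¬ IsEigenvalue A B (pole A B 1))
    (τ : OnePoint ℂ) : ∃ Q, IsMoveI τ A B Q := by
  obtain ⟨f, hf⟩ := exists_isBlock (r := 2) (o := n - 2) (n := n) (by omega)
  have hf0 : (f 0 : ℕ) = n - 2 := hf 0
  have hf1 : (f 1 : ℕ) = n - 2 + 1 := hf 1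
  let e : Fin n := ⟨0, by omega⟩
  let v : Fin 2 → ℂ := fun a => atShift A B τ (f a) e
  have hrow : ∀ i : Fin n, (i : ℕ) < n - 2 → atShift A B τ i e = 0 := fun i hi =>
    h.left.atShift h.right τ i e (by simp only [e]; omega)
  -- Were v zero, the whole first column of A - τB would vanish; then τ = σ_1 and σ_1 would be an
  -- eigenvalue.
  have hv : v ≠ 0 := by
    intro hv
    have h1 : atShift A B τ (f 0) e = 0 := congrFun hv 0
    have h2 := (h.pole_eq_iff (by rw [hf0]; simp only [e]; omega)).2 h1
    apply hp
    rw [show pole A B 1 = τ from h2]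
    refine det_eq_zero_of_column_eq_zero e fun i => ?_
    by_cases hi : (i : ℕ) < n - 2
    · exact hrow i hi
    · obtain ⟨a, rfl⟩ := hf.exists_eq (i := i) (by omega) (by omega)
      exact congrFun hv a
  obtain ⟨Q₂, hQ₂, c, hc, hQc⟩ := exists_unitary_of_orthogonal {(1 : Fin 2)} (fun _ => v)
    (by simpa using hv) (by simp)
  have hc1 : c 1 ≠ 0 := hc 1 rfl
  have hQv : ∀ a, c 1 * (Q₂ᴴ *ᵥ v) a = (1 : Matrix (Fin 2) (Fin 2) ℂ) a 1 := fun a => by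
    rw [← mul_apply_col (hQc 1 rfl)]
    exact congrFun (congrFun (mem_unitaryGroup_iff'.1 hQ₂) a) 1
  obtain ⟨Q, hQ, hQs⟩ := exists_actsOn hf hQ₂
  refine ⟨Q, ?_, (c 1)⁻¹, inv_ne_zero hc1, fun i j hj => ?_⟩
  · unfold IsCore
    convert hQ using 1 <;> omega
  · obtain rfl : j = e := Fin.ext hj
    by_cases hi : (i : ℕ) < n - 2
    · rw [if_neg (by omega)]
      have := conjTranspose_mul_mul_apply_of_one (W := Q) (M := atShift A B τ) (Z := 1) (i := i)
        (j := e) (hQ.apply_col (by omega)) (fun _ => rfl)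
      rw [Matrix.mul_one] at this
      rw [this, hrow i hi]
    · obtain ⟨a, rfl⟩ := hf.exists_eq (i := i) (by omega) (by omega)
      have h1 := congrFun (congrFun
        (hQ.conjTranspose_mul_submatrix hf (atShift A B τ) (fun _ : Fin 1 => e)) a) 0
      rw [hQs] at h1
      have h2 : (Q₂ᴴ * (atShift A B τ).submatrix f (fun _ : Fin 1 => e)) a 0 =
        (Q₂ᴴ *ᵥ v) a := rfl
      rw [submatrix_apply, h2] at h1
      rw [h1, (eq_inv_mul_iff_mul_eq₀ hc1).2 (hQv a), hf]
      obtain rfl | rfl : a = 0 ∨ a = 1 := by omega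
      · rw [if_neg (by rw [Fin.val_zero]; omega), one_apply_ne (by decide), mul_zero]
      · rw [if_pos (by rw [Fin.val_one]; omega), one_apply_eq, mul_one]

theorem IsMoveI.spec (hn : 3 ≤ n) (h : Regular S A B) (hp : ¬ IsEigenvalue A B (pole A B 1))
    {ρ : OnePoint ℂ} {Q : Matrix (Fin n) (Fin n) ℂ} (hQ : IsMoveI ρ A B Q) :
    Regular S (congruence Q A) (congruence Q B) ∧
      pole (congruence Q A) (congruence Q B) 1 = ρ ∧
      (∀ j, 2 ≤ j → j + 2 ≤ n → pole (congruence Q A) (congruence Q B) j = pole A B j) ∧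
      ∀ j, j + 2 ≤ n → (stdSpan n j).map Q.mulVecLin = stdSpan n j := by
  obtain ⟨hcore, γ, hγ, hcol⟩ := hQ
  have hS : ∀ j, j + 2 ≤ n → (stdSpan n j).map Q.mulVecLin = stdSpan n j := fun j hj =>
    hcore.map_stdSpan (by omega)
  have hAH : ∀ M, IsAntiHessenberg M → IsAntiHessenberg (congruence Q M) := by
    intro M hM i j hij
    have : (stdSpan n (j + 1)).map (Qᴴ * M * Q).mulVecLin ≤ botSpan n (j + 2) := by
      rw [map_mul, hS _ (by omega), map_mul,
        ← hcore.conjTranspose.map_botSpan (k := j + 2) (by omega)]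
      exact Submodule.map_mono (isAntiHessenberg_iff.1 hM _)
    exact map_stdSpan_le_botSpan_iff.1 this i j (by omega) (by omega)
  have hent : ∀ M, ∀ i j : Fin n, (i : ℕ) + 2 < n → (j : ℕ) + 2 < n →
      congruence Q M i j = M i j := fun M i j hi hj =>
    conjTranspose_mul_mul_apply_of_one (hcore.apply_col (by omega)) (hcore.apply_col (by omega))
  let e : Fin n := ⟨0, by omega⟩
  let d : Fin n := ⟨n - 2, by omega⟩
  let l : Fin n := ⟨n - 1, by omega⟩
  have hde : (d : ℕ) + e + 2 = n := by simp only [d, e]; omega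
  have hcolQ : ∀ i, Qᴴ i e = (1 : Matrix (Fin n) (Fin n) ℂ) i e :=
    hcore.conjTranspose.apply_col (by simp only [e]; omega)
  have hcolQ' : ∀ i, Q i e = (1 : Matrix (Fin n) (Fin n) ℂ) i e :=
    hcore.apply_col (by simp only [e]; omega)
  -- If both entries vanished, the first columns of the new A and B would be multiples of e_n, so a
  -- suitable p would kill the whole column. Then p is an eigenvalue, and undoing Q, which fixes
  -- e_1, shows p = σ_1.
  have hpr : 0 < ‖congruence Q A d e‖ + ‖congruence Q B d e‖ := by
    by_contra hcon
    rw [norm_add_norm_pos_iff] at hcon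
    push Not at hcon
    set p := ratio (congruence Q A l e) (congruence Q B l e) with hpdef
    have hz : ∀ i, atShift (congruence Q A) (congruence Q B) p i e = 0 := by
      intro i
      rw [atShift_apply]
      by_cases hi : (i : ℕ) + 2 < n
      · rw [hAH A h.left i e (by simp only [e]; omega), hAH B h.right i e (by simp only [e]; omega)]
        simp
      · by_cases hi' : i = d
        · rw [hi', hcon.1, hcon.2]
          simp
        · have hi2 : (i : ℕ) ≠ n - 2 := fun h => hi' (Fin.ext h)
          obtain rfl : i = l := Fin.ext (by simp only [l]; omega)
          exact ratio_spec _ _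
    have hM : atShift A B p d e = 0 := by
      have h1 : atShift A B p = Q * atShift (congruence Q A) (congruence Q B) p * Qᴴ := by
        rw [congruence_atShift, Matrix.mul_assoc, Matrix.mul_assoc, Matrix.mul_assoc,
          unitary_mul_conjTranspose hcore.1, Matrix.mul_one, ← Matrix.mul_assoc,
          unitary_mul_conjTranspose hcore.1, Matrix.one_mul]
      rw [h1, mul_apply_of_col_one hcolQ, mul_apply]
      exact Finset.sum_eq_zero fun i _ => by rw [hz, mul_zero]
    have h2 : pole A B 1 = p := (h.pole_eq_iff hde).2 hM
    apply hp
    rw [h2, ← isEigenvalue_congruence hcore.1]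
    exact det_eq_zero_of_column_eq_zero e hz
  have hproper : IsProper (congruence Q A) (congruence Q B) := by
    intro i j hij
    by_cases hj : (j : ℕ) = 0
    · obtain rfl : j = e := Fin.ext hj
      obtain rfl : i = d := Fin.ext (by simp only [d]; omega)
      exact hpr
    · by_cases hi : (i : ℕ) = 0
      · obtain rfl : i = e := Fin.ext hi
        obtain rfl : j = d := Fin.ext (by simp only [d]; omega)
        exact (h.holds.congruence Q).proper_symm hpr
      · rw [hent A i j (by omega) (by omega), hent B i j (by omega) (by omega)]
        exact h.proper i j hij
  have hR : Regular S (congruence Q A) (congruence Q B) :=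
    ⟨h.holds.congruence Q, hAH A h.left, hAH B h.right, hproper⟩
  refine ⟨hR, ?_, fun j hj hjn => ?_, hS⟩
  · refine (hR.pole_eq_iff hde).2 ?_
    rw [congruence_atShift, mul_apply_of_col_one hcolQ', hcol d e rfl,
      if_neg (by simp only [d]; omega)]
  · obtain ⟨j', rfl⟩ : ∃ j' : Fin n, j = j' + 1 := ⟨⟨j - 1, by omega⟩, by simp; omega⟩
    obtain ⟨i, hij⟩ : ∃ i : Fin n, (i : ℕ) + j' + 2 = n :=
      ⟨⟨n - j' - 2, by omega⟩, by rw [Fin.val_mk]; omega⟩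
    exact pole_congr hij (hent A i j' (by omega) (by omega)) (hent B i j' (by omega) (by omega))

/-! ### Moves of type II -/

theorem exists_moveII (h : Regular S A B) {k : ℕ} (hk : 2 ≤ k) (hkn : 2 * k < n) :
    ∃ Q, IsMoveII k A B Q := by
  by_cases heq : pole A B (k - 1) = pole A B k
  · exact ⟨1, ⟨hk, by omega, Or.inl hkn⟩, Or.inl ⟨heq, rfl⟩⟩
  obtain ⟨o, rfl⟩ : ∃ o, k = o + 2 := ⟨k - 2, by omega⟩
  obtain ⟨o', ho⟩ : ∃ o', n - (o + 2) = o' + 1 := ⟨n - o - 3, by omega⟩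
  have ho' : o' + o + 2 + 1 = n := by omega
  obtain ⟨f, hf⟩ := exists_isBlock (r := 2) (o := o) (n := n) (by omega)
  obtain ⟨g, hg⟩ := exists_isBlock (r := 2) (o := o') (n := n) (by omega)
  have hf0 : (f 0 : ℕ) = o := hf 0
  have hf1 : (f 1 : ℕ) = o + 1 := hf 1
  have hg0 : (g 0 : ℕ) = o' := hg 0
  have hg1 : (g 1 : ℕ) = o' + 1 := hg 1
  have h10 : (g 1 : ℕ) + f 0 + 2 = n := by omega
  have h01 : (g 0 : ℕ) + f 1 + 2 = n := by omega
  have hsub : ∀ (A B : Matrix (Fin n) (Fin n) ℂ) p a b,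
      atShift (A.submatrix g f) (B.submatrix g f) p a b = atShift A B p (g a) (f b) := by
    intros
    rw [atShift_apply, atShift_apply]
    rfl
  have hpk : pole A B (o + 2) = pole A B (f 1 + 1) := by rw [hf1]
  have hpk1 : pole A B (o + 2 - 1) = pole A B (f 0 + 1) := by rw [hf0]; rfl
  obtain ⟨W₂, hW₂, Z₂, hZ₂, hG, hH, hq⟩ := exists_unitary_swap_two (G := A.submatrix g f)
    (H := B.submatrix g f) (h.left _ _ (by omega)) (h.right _ _ (by omega))
    (q := pole A B (f 1 + 1)) (by rw [hsub]; exact atShift_pole_apply A B h01)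
  obtain ⟨W, hW, rfl⟩ := exists_actsOn hg hW₂
  obtain ⟨Z, hZ, rfl⟩ := exists_actsOn hf hZ₂
  rw [← hW.conjTranspose_mul_mul_submatrix hZ hf hg] at hG hH
  rw [← hW.conjTranspose_mul_mul_submatrix hZ hf hg,
    ← hW.conjTranspose_mul_mul_submatrix hZ hf hg, hsub] at hq
  have tri : ∀ M : Matrix (Fin n) (Fin n) ℂ, (Wᴴ * M * Z) (g 0) (f 0) = 0 → ∀ a b : Fin 2,
      (a : ℕ) + b + 1 < 2 → (Wᴴ * M * Z) (g a) (f b) = 0 := by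
    intro M hM a b hab
    obtain rfl : a = 0 := Fin.ext (by simp only [Fin.val_zero]; omega)
    obtain rfl : b = 0 := Fin.ext (by simp only [Fin.val_zero]; omega)
    exact hM
  have hA' := isAntiHessenberg_of_block ho' hW hZ hf hg h.left (tri A hG)
  have hB' := isAntiHessenberg_of_block ho' hW hZ hf hg h.right (tri B hH)
  have hprod := exists_prod_eq (Or.inl rfl) ho' hW hZ hf hg h.left h.right hA' hB'
  have hpr := block_proper (u := fun b => g b.rev) (v := f)
    (fun b => h.proper _ _ (by rw [hf, hg, Fin.val_rev]; omega)) hprod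
  have hpole0 := (pole_eq_iff h10 (hpr 0)).2 hq
  refine ⟨Z * W, ⟨hk, by omega, Or.inl hkn⟩, Or.inr ⟨heq, Z, W, hZ, ?_, rfl, hA', hB', ?_, ?_⟩⟩
  · rw [ho]
    exact hW
  · rw [hpk, ← hpole0, hf0]
    rfl
  · rw [hpk1, show o + 2 = (f 1 : ℕ) + 1 by omega]
    refine (pole_eq_iff h01 (hpr 1)).2 ?_
    refine block_remaining (u := fun b => g b.rev) (v := f) hprod (b₀ := 1) (b₁ := 0)
      (atShift_pole_apply A B h10) fun b hb hcon => ?_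
    obtain rfl : b = 0 := by omega
    exact heq (by rw [hpk, hpk1, ← hpole0]; exact ((pole_eq_iff h10 (hpr 0)).2 hcon).symm)

/-- For 2k < n the windows of Z and W are disjoint, so on the entries near position k the congruence
by ZW coincides with the equivalence W*(A - λB)Z. The mirror entries follow from the structure. In
the last relation both sides equal F_{k-1}. -/
theorem IsMoveII.spec (h : Regular S A B) {k : ℕ} (hk : 2 ≤ k) (hkn : 2 * k < n)
    (hp1 : ¬ IsEigenvalue A B (pole A B (k - 1))) (hp : ¬ IsEigenvalue A B (pole A B k))
    {Q : Matrix (Fin n) (Fin n) ℂ} (hQ : IsMoveII k A B Q) :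
    Q ∈ unitaryGroup (Fin n) ℂ ∧ Regular S (congruence Q A) (congruence Q B) ∧
      pole (congruence Q A) (congruence Q B) (k - 1) = pole A B k ∧
      pole (congruence Q A) (congruence Q B) k = pole A B (k - 1) ∧
      (∀ j, 1 ≤ j → 2 * j < n → j ≠ k - 1 → j ≠ k →
        pole (congruence Q A) (congruence Q B) j = pole A B j) ∧
      (∀ j, 2 * j < n → j ≠ k - 1 → (stdSpan n j).map Q.mulVecLin = stdSpan n j) ∧
      ((stdSpan n (k - 1)).map Q.mulVecLin).map (atShift A B (pole A B k)).mulVecLin =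
        (stdSpan n (k - 1)).map (atShift A B (pole A B (k - 1))).mulVecLin := by
  obtain ⟨-, ⟨heq, rfl⟩ | ⟨-, Z, W, hZ, hW, rfl, hA', hB', hq1, hq⟩⟩ := hQ
  · simp only [congruence_one, map_one]
    exact ⟨one_mem _, h, heq, heq.symm, fun _ _ _ _ _ => trivial, fun _ _ _ => trivial,
      by rw [heq]⟩
  obtain ⟨o, rfl⟩ : ∃ o, k = o + 2 := ⟨k - 2, by omega⟩
  obtain ⟨o', ho⟩ : ∃ o', n - (o + 2) = o' + 1 := ⟨n - o - 3, by omega⟩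
  have ho' : o' + o + 2 + 1 = n := by omega
  rw [ho] at hW
  replace hW : ActsOn (o' + 1) (o' + 2) W := hW
  replace hZ : ActsOn (o + 1) (o + 2) Z := hZ
  have hd : o + 2 < o' + 1 ∨ o' + 2 < o + 1 := by omega
  have hcomm := hZ.commute hW hd
  have hu : Z * W ∈ unitaryGroup (Fin n) ℂ := mul_mem hZ.1 hW.1
  have hcolZ : ∀ j : Fin n, ¬ (o' ≤ (j : ℕ) ∧ (j : ℕ) ≤ o' + 1) → ∀ l, (Z * W) l j = Z l j :=
    fun j hj => mul_apply_of_col_one (hW.apply_col (by omega))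
  have hcolW : ∀ j : Fin n, ¬ (o ≤ (j : ℕ) ∧ (j : ℕ) ≤ o + 1) → ∀ l, (Z * W) l j = W l j := by
    rw [hcomm]
    exact fun j hj => mul_apply_of_col_one (hZ.apply_col (by omega))
  have hent : ∀ M, ∀ i j : Fin n, ¬ (o ≤ (i : ℕ) ∧ (i : ℕ) ≤ o + 1) →
      ¬ (o' ≤ (j : ℕ) ∧ (j : ℕ) ≤ o' + 1) → congruence (Z * W) M i j = (Wᴴ * M * Z) i j :=
    fun M i j hi hj => conjTranspose_mul_mul_apply_congr (hcolW i hi) (hcolZ j hj)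
  have hfix : ∀ M, ∀ i j : Fin n, ¬ (o ≤ (i : ℕ) ∧ (i : ℕ) ≤ o + 1) →
      ¬ (o' ≤ (j : ℕ) ∧ (j : ℕ) ≤ o' + 1) → ¬ (o' ≤ (i : ℕ) ∧ (i : ℕ) ≤ o' + 1) →
      ¬ (o ≤ (j : ℕ) ∧ (j : ℕ) ≤ o + 1) → congruence (Z * W) M i j = M i j := by
    intro M i j h1 h2 h3 h4
    rw [hent M i j h1 h2]
    exact conjTranspose_mul_mul_apply_of_one (hW.apply_col (by omega)) (hZ.apply_col (by omega))
  have hS := h.holds.congruence (Z * W)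
  -- Entries with both indices in the window of Z are seen neither by the equivalence nor by its
  -- mirror image. They lie strictly above the antidiagonal and stay zero because ZW fixes E_{o+2}
  -- and (ZW)* fixes F_{o+3}.
  have hmid : ∀ M, IsAntiHessenberg M → ∀ i j : Fin n, (i : ℕ) < o' → (j : ℕ) < o + 2 →
      congruence (Z * W) M i j = 0 := by
    intro M hM i j hi hj
    have : (stdSpan n (o + 2)).map ((Z * W)ᴴ * M * (Z * W)).mulVecLin ≤ botSpan n (o + 3) := by
      rw [map_mul, map_mul, map_mul, hW.map_stdSpan (by omega), hZ.map_stdSpan (by omega),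
        conjTranspose_mul, map_mul, ← hW.conjTranspose.map_botSpan (k := o + 3) (by omega)]
      refine Submodule.map_mono ?_
      rw [← hZ.conjTranspose.map_botSpan (k := o + 3) (by omega)]
      exact Submodule.map_mono (isAntiHessenberg_iff.1 hM _)
    exact map_stdSpan_le_botSpan_iff.1 this i j (by omega) hj
  have hAH : ∀ i j : Fin n, (i : ℕ) + j + 2 < n →
      congruence (Z * W) A i j = 0 ∧ congruence (Z * W) B i j = 0 := by
    intro i j hij
    by_cases h1 : ¬ (o ≤ (i : ℕ) ∧ (i : ℕ) ≤ o + 1) ∧ ¬ (o' ≤ (j : ℕ) ∧ (j : ℕ) ≤ o' + 1)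
    · rw [hent A i j h1.1 h1.2, hent B i j h1.1 h1.2]
      exact ⟨hA' i j hij, hB' i j hij⟩
    by_cases h2 : ¬ (o ≤ (j : ℕ) ∧ (j : ℕ) ≤ o + 1) ∧ ¬ (o' ≤ (i : ℕ) ∧ (i : ℕ) ≤ o' + 1)
    · refine hS.zero_symm ?_
      rw [hent A j i h2.1 h2.2, hent B j i h2.1 h2.2]
      exact ⟨hA' j i (by omega), hB' j i (by omega)⟩
    exact ⟨hmid A h.left i j (by omega) (by omega), hmid B h.right i j (by omega) (by omega)⟩
  obtain ⟨f, hf⟩ := exists_isBlock (r := 2) (o := o) (n := n) (by omega)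
  obtain ⟨g, hg⟩ := exists_isBlock (r := 2) (o := o') (n := n) (by omega)
  have hpr := block_proper (u := fun b => g b.rev) (v := f)
    (fun b => h.proper _ _ (by rw [hf, hg, Fin.val_rev]; omega))
    (exists_prod_eq (Or.inl rfl) ho' hW hZ hf hg h.left h.right hA' hB')
  have hblk : ∀ i j : Fin n, (i : ℕ) + j + 2 = n → (o ≤ (j : ℕ) ∧ (j : ℕ) ≤ o + 1) →
      0 < ‖congruence (Z * W) A i j‖ + ‖congruence (Z * W) B i j‖ := by
    intro i j hij hj
    rw [hent A i j (by omega) (by omega), hent B i j (by omega) (by omega)]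
    obtain ⟨b, rfl⟩ := hf.exists_eq (i := j) (by omega) (by omega)
    have hfb := hf b
    have hgb := hg b.rev
    rw [Fin.val_rev] at hgb
    obtain rfl : g b.rev = i := Fin.ext (by omega)
    exact hpr b
  have hproper : IsProper (congruence (Z * W) A) (congruence (Z * W) B) := by
    intro i j hij
    by_cases hj : o ≤ (j : ℕ) ∧ (j : ℕ) ≤ o + 1
    · exact hblk i j hij hj
    by_cases hj' : o' ≤ (j : ℕ) ∧ (j : ℕ) ≤ o' + 1
    · exact hS.proper_symm (hblk j i (by omega) (by omega))
    · rw [hfix A i j (by omega) hj' (by omega) hj, hfix B i j (by omega) hj' (by omega) hj]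
      exact h.proper i j hij
  have hR : Regular S (congruence (Z * W) A) (congruence (Z * W) B) :=
    ⟨hS, fun i j hij => (hAH i j hij).1, fun i j hij => (hAH i j hij).2, hproper⟩
  have hpole : ∀ j : ℕ, o + 1 ≤ j → j ≤ o + 2 →
      pole (congruence (Z * W) A) (congruence (Z * W) B) j =
        pole (Wᴴ * A * Z) (Wᴴ * B * Z) j := by
    intro j hj1 hj2
    obtain ⟨j', rfl⟩ : ∃ j' : Fin n, j = j' + 1 := ⟨⟨j - 1, by omega⟩, by simp; omega⟩
    obtain ⟨i, hij⟩ : ∃ i : Fin n, (i : ℕ) + j' + 2 = n :=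
      ⟨⟨n - j' - 2, by omega⟩, by rw [Fin.val_mk]; omega⟩
    exact pole_congr hij (hent A i j' (by omega) (by omega)) (hent B i j' (by omega) (by omega))
  refine ⟨hu, hR, ?_, ?_, fun j hj hjn h1 h2 => ?_, fun j hjn h1 => ?_, ?_⟩
  · rw [hpole _ (by omega) (by omega), hq1]
  · rw [hpole _ (by omega) (by omega), hq]
  · obtain ⟨j', rfl⟩ : ∃ j' : Fin n, j = j' + 1 := ⟨⟨j - 1, by omega⟩, by simp; omega⟩
    obtain ⟨i, hij⟩ : ∃ i : Fin n, (i : ℕ) + j' + 2 = n :=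
      ⟨⟨n - j' - 2, by omega⟩, by rw [Fin.val_mk]; omega⟩
    exact pole_congr hij (hfix A i j' (by omega) (by omega) (by omega) (by omega))
      (hfix B i j' (by omega) (by omega) (by omega) (by omega))
  · rw [map_mul, hW.map_stdSpan (by omega), hZ.map_stdSpan (by omega)]
  · rw [map_stdSpan_pole h.left h.right (by omega) (by omega) hp1, map_mul,
      hW.map_stdSpan (by omega), ← hq1]
    rw [← hq1] at hp
    exact map_swapped hW.1 hZ.1 hA' hB' (by omega) (by omega) hp (hW.map_botSpan (by omega))

/-! ### Swapping the shifts in the middle -/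

theorem Regular.congruence_block (hr : r = 2 ∨ r = 3) (ho : o + o + r + 1 = n) (h : Regular S A B)
    {Q : Matrix (Fin n) (Fin n) ℂ} (hQ : ActsOn (o + 1) (o + r) Q)
    (hA' : IsAntiHessenberg (congruence Q A)) (hB' : IsAntiHessenberg (congruence Q B)) :
    Regular S (congruence Q A) (congruence Q B) := by
  have hfix : ∀ M, ∀ i j : Fin n, ((i : ℕ) < o ∨ o + r ≤ i) → ((j : ℕ) < o ∨ o + r ≤ j) →
      congruence Q M i j = M i j := fun M i j hi hj =>
    conjTranspose_mul_mul_apply_of_one (hQ.apply_col (by omega)) (hQ.apply_col (by omega))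
  obtain ⟨f, hf⟩ := exists_isBlock (r := r) (o := o) (n := n) (by omega)
  have hpr := block_proper (u := fun b => f b.rev) (v := f)
    (fun b => h.proper _ _ (by rw [hf, hf, Fin.val_rev]; omega))
    (exists_prod_eq hr ho hQ hQ hf hf h.left h.right hA' hB')
  refine ⟨h.holds.congruence Q, hA', hB', ?_⟩
  intro i j hij
  by_cases hj : (j : ℕ) < o ∨ o + r ≤ j
  · rw [hfix A i j (by omega) hj, hfix B i j (by omega) hj]
    exact h.proper i j hij
  · obtain ⟨b, rfl⟩ := hf.exists_eq (i := j) (by omega) (by omega)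
    have hfb := hf b
    have hgb := hf b.rev
    rw [Fin.val_rev] at hgb
    obtain rfl : f b.rev = i := Fin.ext (by omega)
    exact hpr b

/-- The two end poles of the central block are companions, so the swap replaces the pole in position
o+1 by its companion. Both sides of the last relation equal F_{o+1}. The cases r = 2 and r = 3 are n
odd and n even. -/
theorem middle_spec (hr : r = 2 ∨ r = 3) (ho : o + o + r + 1 = n) (h : Regular S A B)
    {Q : Matrix (Fin n) (Fin n) ℂ} (hQ : ActsOn (o + 1) (o + r) Q)
    (hA' : IsAntiHessenberg (congruence Q A)) (hB' : IsAntiHessenberg (congruence Q B))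
    (hp : ¬ IsEigenvalue A B (pole A B (o + 1)))
    (hq : pole (congruence Q A) (congruence Q B) (o + 1) = pole A B (o + r)) :
    Regular S (congruence Q A) (congruence Q B) ∧
      pole (congruence Q A) (congruence Q B) (o + 1) = S.companion (pole A B (o + 1)) ∧
      (∀ j, 1 ≤ j → j ≤ o → pole (congruence Q A) (congruence Q B) j = pole A B j) ∧
      (∀ j, j ≤ o → (stdSpan n j).map Q.mulVecLin = stdSpan n j) ∧
      ((stdSpan n (o + 1)).map Q.mulVecLin).map
          (atShift A B (S.companion (pole A B (o + 1)))).mulVecLin =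
        (stdSpan n (o + 1)).map (atShift A B (pole A B (o + 1))).mulVecLin := by
  have hcomp : pole A B (o + r) = S.companion (pole A B (o + 1)) :=
    h.pole_companion (by omega) (by omega) (by omega)
  have hfix : ∀ M, ∀ i j : Fin n, ((i : ℕ) < o ∨ o + r ≤ i) → ((j : ℕ) < o ∨ o + r ≤ j) →
      congruence Q M i j = M i j := fun M i j hi hj =>
    conjTranspose_mul_mul_apply_of_one (hQ.apply_col (by omega)) (hQ.apply_col (by omega))
  refine ⟨h.congruence_block hr ho hQ hA' hB', hq.trans hcomp, fun j hj hjo => ?_,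
    fun j hjo => hQ.map_stdSpan (by omega), ?_⟩
  · obtain ⟨j', rfl⟩ : ∃ j' : Fin n, j = j' + 1 := ⟨⟨j - 1, by omega⟩, by simp; omega⟩
    obtain ⟨i, hij⟩ : ∃ i : Fin n, (i : ℕ) + j' + 2 = n :=
      ⟨⟨n - j' - 2, by omega⟩, by rw [Fin.val_mk]; omega⟩
    exact pole_congr hij (hfix A i j' (by omega) (by omega)) (hfix B i j' (by omega) (by omega))
  · have hp' := h.holds.not_isEigenvalue_companion hp
    rw [map_stdSpan_pole h.left h.right (by omega) (by omega) hp]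
    rw [← hq.trans hcomp] at hp' ⊢
    exact map_swapped hQ.1 hQ.1 hA' hB' (by omega) (by omega) hp' (hQ.map_botSpan (by omega))

theorem exists_middle (hr : r = 2 ∨ r = 3) (ho : o + o + r + 1 = n) (h : Regular S A B)
    (hp : pole A B (o + 1) ≠ S.companion (pole A B (o + 1))) :
    ∃ Q : Matrix (Fin n) (Fin n) ℂ, ActsOn (o + 1) (o + r) Q ∧
      IsAntiHessenberg (congruence Q A) ∧ IsAntiHessenberg (congruence Q B) ∧
      pole (congruence Q A) (congruence Q B) (o + 1) = pole A B (o + r) ∧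
      pole (congruence Q A) (congruence Q B) (o + r) = pole A B (o + 1) ∧
      (r = 3 → pole A B (o + 1) ≠ pole A B (o + 2) ∧ pole A B (o + 2) ≠ pole A B (o + 3) ∧
        pole (congruence Q A) (congruence Q B) (o + 2) = pole A B (o + 2)) := by
  have hc1 : pole A B (o + r) = S.companion (pole A B (o + 1)) :=
    h.pole_companion (by omega) (by omega) (by omega)
  have hc2 : pole A B (o + 1) = S.companion (pole A B (o + r)) :=
    h.pole_companion (by omega) (by omega) (by omega)
  obtain ⟨f, hf⟩ := exists_isBlock (r := r) (o := o) (n := n) (by omega)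
  let i₀ : Fin r := ⟨0, by omega⟩
  let i₁ : Fin r := ⟨r - 1, by omega⟩
  have hf0 : (f i₀ : ℕ) = o := hf i₀
  have hf1 : (f i₁ : ℕ) = o + (r - 1) := hf i₁
  have hsub : ∀ (A B : Matrix (Fin n) (Fin n) ℂ) p a b,
      atShift (A.submatrix f f) (B.submatrix f f) p a b = atShift A B p (f a) (f b) := by
    intros
    rw [atShift_apply, atShift_apply]
    rfl
  have hpos : ∀ b : Fin r, (f b.rev : ℕ) + f b + 2 = n := fun b => by
    rw [hf, hf, Fin.val_rev]; omega
  have hp1 : o + r = f i₁ + 1 := by omega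
  have hp0 : o + 1 = f i₀ + 1 := by omega
  have hr0 : i₁ = i₀.rev := Fin.ext (by rw [Fin.val_rev])
  have hdet : (atShift (A.submatrix f f) (B.submatrix f f) (pole A B (o + r))).det = 0 := by
    rw [det_of_antiTriangular hr, neg_eq_zero]
    · refine Finset.prod_eq_zero (Finset.mem_univ i₁) ?_
      rw [hsub, hp1]
      exact atShift_pole_apply A B (hpos i₁)
    · intro a b hab
      rw [hsub]
      exact h.left.atShift h.right _ _ _ (by rw [hf, hf]; omega)
  obtain ⟨Q₂, hQ₂, hz, hz', hq⟩ := exists_unitary_swap_ends (h.holds.submatrix f)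
    (i₀ := i₀) (i₁ := i₁) (fun h => by have := congrArg Fin.val h; simp only [i₀, i₁] at this; omega)
    (by rw [← hc2, hc1]; exact hp.symm) hdet
  obtain ⟨Q, hQ, rfl⟩ := exists_actsOn hf hQ₂
  simp only [← hQ.conjTranspose_mul_mul_submatrix hQ hf hf, hsub] at hz hz' hq
  have hzero : ∀ a b : Fin r, (a : ℕ) + b + 1 < r →
      (Qᴴ * A * Q) (f a) (f b) = 0 ∧ (Qᴴ * B * Q) (f a) (f b) = 0 := by
    intro a b hab
    by_cases hb : (b : ℕ) = 0
    · obtain rfl : b = i₀ := Fin.ext hb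
      exact hz a fun h => by rw [h] at hab; simp only [i₁] at hab; omega
    · obtain rfl : a = i₀ := Fin.ext (by simp only [i₀]; omega)
      exact hz' b fun h => by rw [h] at hab; simp only [i₁] at hab; omega
  have hA' := isAntiHessenberg_of_block ho hQ hQ hf hf h.left fun a b hab => (hzero a b hab).1
  have hB' := isAntiHessenberg_of_block ho hQ hQ hf hf h.right fun a b hab => (hzero a b hab).2
  have hprod := exists_prod_eq hr ho hQ hQ hf hf h.left h.right hA' hB'
  have hpr := block_proper (u := fun b => f b.rev) (v := f)
    (fun b => h.proper _ _ (hpos b)) hprod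
  have hq0 : pole (Qᴴ * A * Q) (Qᴴ * B * Q) (o + 1) = pole A B (o + r) := by
    rw [hr0] at hq
    rw [hp0]
    exact (pole_eq_iff (hpos i₀) (hpr i₀)).2 hq
  -- The other end needs no computation: the new pencil is structured, so its pole there is the
  -- companion of the one just placed.
  have hcomp' : pole (Qᴴ * A * Q) (Qᴴ * B * Q) (o + r) = pole A B (o + 1) := by
    have hR := h.congruence_block hr ho hQ hA' hB'
    rw [hc2, ← hq0]
    exact hR.pole_companion (by omega) (by omega) (by omega)
  refine ⟨Q, hQ, hA', hB', hq0, hcomp', ?_⟩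
  rintro rfl
  have hc3 : pole A B (o + 2) = S.companion (pole A B (o + 2)) :=
    h.pole_companion (by omega) (by omega) (by omega)
  -- The central pole for even n is its own companion, so it differs from a pole that is not.
  have h12 : pole A B (o + 1) ≠ pole A B (o + 2) := fun h => hp (by rw [h]; exact hc3)
  have h23 : pole A B (o + 2) ≠ pole A B (o + 3) := fun h => h12 (by rw [hc2, ← h]; exact hc3.symm)
  refine ⟨h12, h23, ?_⟩
  have hf2 : (f 1 : ℕ) = o + 1 := hf 1
  rw [show o + 2 = (f 1 : ℕ) + 1 by omega]
  refine (pole_eq_iff (hpos 1) (hpr 1)).2 ?_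
  -- The central pole must occur among the new poles, and the two ends are already taken by
  -- different ones.
  refine block_remaining (u := fun b => f b.rev) (v := f) hprod (b₀ := 1) (b₁ := 1)
      (atShift_pole_apply A B (hpos 1)) fun b hb hcon => ?_
  have hb' := (pole_eq_iff (hpos b) (hpr b)).2 hcon
  have : b = 0 ∨ b = 2 := by omega
  rcases this with rfl | rfl
  · have e : (f 0 : ℕ) = o := hf 0
    rw [e, hf2] at hb'
    exact h23 (hb'.symm.trans hq0)
  · have e : (f 2 : ℕ) = o + 2 := hf 2
    rw [e, hf2] at hb'
    exact h12 (hcomp'.symm.trans hb')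

end Moves

/-! ### The middle move, uniformly in the parity of n. -/

section MiddleMove

variable {n : ℕ} {S : Kind} {A B : Matrix (Fin n) (Fin n) ℂ}

/-- The middle move of the iteration. -/
def middleMove (n : ℕ) : Move := if n % 2 = 1 then Move.IIo else Move.IIe

theorem exists_middleMove (hn : 3 ≤ n) (h : Regular S A B) {m : ℕ} (hm : m = (n - 1) / 2)
    (hp : pole A B m ≠ S.companion (pole A B m)) : ∃ Q, (middleMove n).Performs A B Q := by
  obtain ⟨o, rfl⟩ : ∃ o, m = o + 1 := ⟨m - 1, by omega⟩
  unfold middleMove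
  split_ifs with hodd
  · obtain ⟨Q, hQ, hA, hB, h1, h2, -⟩ := exists_middle (r := 2) (Or.inl rfl) (by omega) h hp
    refine ⟨Q, o + 2, by omega, ?_, hQ, hA, hB, h1, h2⟩
    rwa [h.pole_companion (j := o + 1) (k := o + 2) (by omega) (by omega) (by omega)]
  · obtain ⟨Q, hQ, hA, hB, h1, h2, h3⟩ := exists_middle (r := 3) (Or.inr rfl) (by omega) h hp
    obtain ⟨h4, h5, h6⟩ := h3 rfl
    refine ⟨Q, o + 2, by omega, h4, h5, ?_, hQ, hA, hB, h1, h6, h2⟩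
    show pole A B (o + 1) ≠ pole A B (o + 3)
    rwa [h.pole_companion (j := o + 1) (k := o + 3) (by omega) (by omega) (by omega)]

theorem middleMove_spec (hn : 3 ≤ n) (h : Regular S A B) {m : ℕ} (hm : m = (n - 1) / 2)
    (hp : ¬ IsEigenvalue A B (pole A B m)) {Q : Matrix (Fin n) (Fin n) ℂ}
    (hQ : (middleMove n).Performs A B Q) :
    Q ∈ unitaryGroup (Fin n) ℂ ∧ Regular S (congruence Q A) (congruence Q B) ∧
      pole (congruence Q A) (congruence Q B) m = S.companion (pole A B m) ∧
      (∀ j, 1 ≤ j → j < m → pole (congruence Q A) (congruence Q B) j = pole A B j) ∧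
      (∀ j, j < m → (stdSpan n j).map Q.mulVecLin = stdSpan n j) ∧
      ((stdSpan n m).map Q.mulVecLin).map (atShift A B (S.companion (pole A B m))).mulVecLin =
        (stdSpan n m).map (atShift A B (pole A B m)).mulVecLin := by
  obtain ⟨o, rfl⟩ : ∃ o, m = o + 1 := ⟨m - 1, by omega⟩
  unfold middleMove at hQ
  simp only [Nat.lt_succ_iff]
  split_ifs at hQ with hodd
  · obtain ⟨k, hk, -, hcore, hA, hB, h1, -⟩ := hQ
    obtain rfl : k = o + 2 := by omega
    exact ⟨hcore.1, middle_spec (r := 2) (Or.inl rfl) (by omega) h hcore hA hB hp h1⟩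
  · obtain ⟨k, hk, -, -, -, hact, hA, hB, h1, -, -⟩ := hQ
    obtain rfl : k = o + 2 := by omega
    exact ⟨hact.1, middle_spec (r := 3) (Or.inr rfl) (by omega) h hact hA hB hp h1⟩

end MiddleMove

/-! ### Composing moves: feasibility and invariants together. -/

section Steps

variable {n : ℕ} {A B : Matrix (Fin n) (Fin n) ℂ}

theorem run_append {l₁ l₂ : List Move} {Q : Matrix (Fin n) (Fin n) ℂ} :
    ∀ {A B}, Run (l₁ ++ l₂) A B Q ↔ ∃ Q₁ Q₂, Run l₁ A B Q₁ ∧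
      Run l₂ (congruence Q₁ A) (congruence Q₁ B) Q₂ ∧ Q = Q₁ * Q₂ := by
  induction l₁ generalizing Q with
  | nil => simp [Run, congruence_one]
  | cons a l ih =>
    intro A B
    simp only [List.cons_append, Run, ih]
    constructor
    · rintro ⟨Q₁, _, h1, ⟨Q₂, Q₃, h2, h3, rfl⟩, rfl⟩
      exact ⟨Q₁ * Q₂, Q₃, ⟨Q₁, Q₂, h1, h2, rfl⟩, by simpa only [congruence_mul] using h3,
        (Matrix.mul_assoc _ _ _).symm⟩
    · rintro ⟨_, Q₃, ⟨Q₁, Q₂, h1, h2, rfl⟩, h3, rfl⟩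
      exact ⟨Q₁, Q₂ * Q₃, h1, ⟨Q₂, Q₃, h2, by simpa only [congruence_mul] using h3, rfl⟩,
        Matrix.mul_assoc _ _ _⟩

/-- From every accumulated transformation satisfying `P`, the moves of `l` can be performed on the
current pencil, and however this is done, the new accumulated transformation satisfies `P'`. -/
def Steps (A B : Matrix (Fin n) (Fin n) ℂ) (l : List Move)
    (P P' : Matrix (Fin n) (Fin n) ℂ → Prop) : Prop :=
  ∀ Q₀, P Q₀ → (∃ Q, Run l (congruence Q₀ A) (congruence Q₀ B) Q) ∧
    ∀ Q, Run l (congruence Q₀ A) (congruence Q₀ B) Q → P' (Q₀ * Q)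

theorem Steps.nil {P : Matrix (Fin n) (Fin n) ℂ → Prop} : Steps A B [] P P := by
  intro Q₀ h
  refine ⟨⟨1, rfl⟩, ?_⟩
  rintro _ rfl
  rwa [Matrix.mul_one]

theorem Steps.append {l₁ l₂ : List Move} {P P' P'' : Matrix (Fin n) (Fin n) ℂ → Prop}
    (h₁ : Steps A B l₁ P P') (h₂ : Steps A B l₂ P' P'') : Steps A B (l₁ ++ l₂) P P'' := by
  intro Q₀ h
  obtain ⟨⟨Q, hQ⟩, h1⟩ := h₁ Q₀ h
  constructor
  · obtain ⟨⟨Q', hQ'⟩, -⟩ := h₂ _ (h1 Q hQ)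
    simp only [congruence_mul] at hQ'
    exact ⟨Q * Q', run_append.2 ⟨Q, Q', hQ, hQ', rfl⟩⟩
  · intro R hR
    obtain ⟨Q₁, Q₂, hQ₁, hQ₂, rfl⟩ := run_append.1 hR
    rw [← Matrix.mul_assoc]
    refine (h₂ _ (h1 Q₁ hQ₁)).2 Q₂ ?_
    simpa only [congruence_mul] using hQ₂

theorem Steps.single {a : Move} {P P' : Matrix (Fin n) (Fin n) ℂ → Prop}
    (h : ∀ Q₀, P Q₀ → (∃ Q, a.Performs (congruence Q₀ A) (congruence Q₀ B) Q) ∧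
      ∀ Q, a.Performs (congruence Q₀ A) (congruence Q₀ B) Q → P' (Q₀ * Q)) :
    Steps A B [a] P P' := by
  intro Q₀ h0
  obtain ⟨⟨Q, hQ⟩, h1⟩ := h Q₀ h0
  refine ⟨⟨Q, Q, 1, hQ, rfl, (Matrix.mul_one Q).symm⟩, ?_⟩
  rintro _ ⟨Q₁, _, h2, rfl, rfl⟩
  rw [Matrix.mul_one]
  exact h1 Q₁ h2

end Steps

/-! ### The travelling pole and the invariant it maintains. -/

section Iteration

variable {n : ℕ} {S : Kind} {A B : Matrix (Fin n) (Fin n) ℂ}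

/-- The state of the iteration with accumulated transformation `Q` in which the travelling pole
`μ` sits in position `t ≤ m`: the poles in positions before `t` have been shifted by one, and the
subspaces `Q E_j`, `j ≤ m`, have been acted on by the corresponding rational functions. -/
structure State (S : Kind) (A B : Matrix (Fin n) (Fin n) ℂ) (ρ : OnePoint ℂ) (m t : ℕ)
    (μ : OnePoint ℂ) (Q : Matrix (Fin n) (Fin n) ℂ) : Prop where
  unitary : Q ∈ unitaryGroup (Fin n) ℂ
  regular : Regular S (congruence Q A) (congruence Q B)
  pole_lt : ∀ j, 1 ≤ j → j < t → pole (congruence Q A) (congruence Q B) j = pole A B (j + 1)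
  pole_eq : pole (congruence Q A) (congruence Q B) t = μ
  pole_gt : ∀ j, t < j → j ≤ m → pole (congruence Q A) (congruence Q B) j = pole A B j
  track_lt : ∀ j, 1 ≤ j → j < t →
    ((stdSpan n j).map Q.mulVecLin).map (atShift A B (pole A B (j + 1))).mulVecLin =
      (stdSpan n j).map (atShift A B ρ).mulVecLin
  track_ge : ∀ j, t ≤ j → j ≤ m →
    ((stdSpan n j).map Q.mulVecLin).map (atShift A B μ).mulVecLin =
      (stdSpan n j).map (atShift A B ρ).mulVecLin

/-- Cancelling Q* turns a relation for the current pencil into one for the original pencil, the form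
in which `State` records them. -/
theorem map_atShift_of_congruence {Q : Matrix (Fin n) (Fin n) ℂ}
    (hQ : Q ∈ unitaryGroup (Fin n) ℂ) {p q : OnePoint ℂ} {U V : Submodule ℂ (Fin n → ℂ)}
    (h : U.map (atShift (congruence Q A) (congruence Q B) p).mulVecLin =
      V.map (atShift (congruence Q A) (congruence Q B) q).mulVecLin) :
    (U.map Q.mulVecLin).map (atShift A B p).mulVecLin =
      (V.map Q.mulVecLin).map (atShift A B q).mulVecLin := by
  rw [congruence_atShift, congruence_atShift, map_mul, map_mul, map_mul, map_mul] at h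
  exact map_cancel (by rw [det_conjTranspose]; exact star_ne_zero.2 (unitary_det_ne_zero hQ)) h

variable {ρ : OnePoint ℂ} {m : ℕ}

theorem steps_insert (hn : 3 ≤ n) (hm : m = (n - 1) / 2) (h : Regular S A B)
    (hσ : ∀ k, 1 ≤ k → k ≤ n - 1 → ¬ IsEigenvalue A B (pole A B k)) :
    Steps A B [Move.I ρ] (· = 1) (State S A B ρ m 1 ρ) := by
  refine Steps.single ?_
  rintro _ rfl
  simp only [congruence_one, Matrix.one_mul]
  refine ⟨exists_moveI hn h (hσ 1 le_rfl (by omega)) ρ, fun Q hQ => ?_⟩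
  obtain ⟨h1, h2, h3, h4⟩ := IsMoveI.spec hn h (hσ 1 le_rfl (by omega)) hQ
  exact ⟨hQ.1.1, h1, fun j _ _ => by omega, h2, fun j hj hjm => h3 j hj (by omega),
    fun j _ _ => by omega, fun j _ _ => by rw [h4 j (by omega)]⟩

/-- Only Q E_t changes among the tracked subspaces; its relation trades μ for the pole σ_{t+1} that
moves down past it. -/
theorem steps_up (hm : m = (n - 1) / 2)
    (hσ : ∀ k, 1 ≤ k → k ≤ n - 1 → ¬ IsEigenvalue A B (pole A B k)) {μ : OnePoint ℂ}
    (hμ : ¬ IsEigenvalue A B μ) {t : ℕ} (ht : 1 ≤ t) (htm : t < m) :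
    Steps A B [Move.II (t + 1)] (State S A B ρ m t μ) (State S A B ρ m (t + 1) μ) := by
  refine Steps.single fun Q₀ h₀ => ⟨exists_moveII h₀.regular (by omega) (by omega), fun Q hQ => ?_⟩
  have hp := h₀.pole_gt (t + 1) (by omega) (by omega)
  obtain ⟨h1, h2, h3, h4, h5, h6, h7⟩ := IsMoveII.spec h₀.regular (by omega) (by omega)
    (by rw [Nat.add_sub_cancel, h₀.pole_eq, isEigenvalue_congruence h₀.unitary]; exact hμ)
    (by rw [hp, isEigenvalue_congruence h₀.unitary]; exact hσ _ (by omega) (by omega)) hQ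
  rw [Nat.add_sub_cancel] at h3 h4 h6 h7
  rw [h₀.pole_eq] at h4 h7
  rw [hp] at h3 h7
  simp only [Nat.add_sub_cancel] at h5
  refine ⟨mul_mem h₀.unitary h1, ?_, ?_, ?_, ?_, ?_, ?_⟩
  · simpa only [congruence_mul] using h2
  · intro j hj hjt
    simp only [congruence_mul]
    by_cases hjt' : j = t
    · rw [hjt', h3]
    · rw [h5 j hj (by omega) hjt' (by omega), h₀.pole_lt j hj (by omega)]
  · simpa only [congruence_mul] using h4
  · intro j hj hjm
    simp only [congruence_mul]
    rw [h5 j (by omega) (by omega) (by omega) (by omega), h₀.pole_gt j (by omega) hjm]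
  · intro j hj hjt
    rw [map_mul]
    by_cases hjt' : j = t
    · rw [hjt', map_atShift_of_congruence h₀.unitary h7, h₀.track_ge t le_rfl htm.le]
    · rw [h6 j (by omega) hjt', h₀.track_lt j hj (by omega)]
  · intro j hj hjm
    rw [map_mul, h6 j (by omega) (by omega), h₀.track_ge j (by omega) hjm]

/-- The reverse trade: σ_{t+1} in the relation for Q E_t becomes μ. With μ = ρ̃ this produces the
denominator of the final rational function. -/
theorem steps_down (hm : m = (n - 1) / 2)
    (hσ : ∀ k, 1 ≤ k → k ≤ n - 1 → ¬ IsEigenvalue A B (pole A B k)) {μ : OnePoint ℂ}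
    (hμ : ¬ IsEigenvalue A B μ) {t : ℕ} (ht : 1 ≤ t) (htm : t < m) :
    Steps A B [Move.II (t + 1)] (State S A B ρ m (t + 1) μ) (State S A B ρ m t μ) := by
  refine Steps.single fun Q₀ h₀ => ⟨exists_moveII h₀.regular (by omega) (by omega), fun Q hQ => ?_⟩
  have hp := h₀.pole_lt t ht (by omega)
  obtain ⟨h1, h2, h3, h4, h5, h6, h7⟩ := IsMoveII.spec h₀.regular (by omega) (by omega)
    (by
      rw [Nat.add_sub_cancel, hp, isEigenvalue_congruence h₀.unitary]
      exact hσ _ (by omega) (by omega))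
    (by rw [h₀.pole_eq, isEigenvalue_congruence h₀.unitary]; exact hμ) hQ
  rw [Nat.add_sub_cancel] at h3 h4 h6 h7
  rw [h₀.pole_eq] at h3 h7
  rw [hp] at h4 h7
  simp only [Nat.add_sub_cancel] at h5
  refine ⟨mul_mem h₀.unitary h1, ?_, ?_, ?_, ?_, ?_, ?_⟩
  · simpa only [congruence_mul] using h2
  · intro j hj hjt
    simp only [congruence_mul]
    rw [h5 j hj (by omega) (by omega) (by omega), h₀.pole_lt j hj (by omega)]
  · simpa only [congruence_mul] using h3
  · intro j hj hjm
    simp only [congruence_mul]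
    by_cases hjt' : j = t + 1
    · rw [hjt', h4]
    · rw [h5 j (by omega) (by omega) (by omega) hjt', h₀.pole_gt j (by omega) hjm]
  · intro j hj hjt
    rw [map_mul, h6 j (by omega) (by omega), h₀.track_lt j hj (by omega)]
  · intro j hj hjm
    rw [map_mul]
    by_cases hjt' : j = t
    · rw [hjt', map_atShift_of_congruence h₀.unitary h7, h₀.track_lt t ht (by omega)]
    · rw [h6 j (by omega) hjt', h₀.track_ge j (by omega) hjm]

theorem steps_middle (hn : 3 ≤ n) (hm : m = (n - 1) / 2) (hρ : ρ ≠ S.companion ρ)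
    (hρe : ¬ IsEigenvalue A B ρ) :
    Steps A B [middleMove n] (State S A B ρ m m ρ) (State S A B ρ m m (S.companion ρ)) := by
  refine Steps.single fun Q₀ h₀ => ⟨exists_middleMove hn h₀.regular hm (by rwa [h₀.pole_eq]),
    fun Q hQ => ?_⟩
  obtain ⟨h1, h2, h3, h4, h5, h6⟩ := middleMove_spec hn h₀.regular hm
    (by rw [h₀.pole_eq, isEigenvalue_congruence h₀.unitary]; exact hρe) hQ
  rw [h₀.pole_eq] at h3 h6
  refine ⟨mul_mem h₀.unitary h1, ?_, ?_, ?_, fun j _ _ => by omega, ?_, ?_⟩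
  · simpa only [congruence_mul] using h2
  · intro j hj hjm
    simp only [congruence_mul]
    rw [h4 j hj hjm, h₀.pole_lt j hj hjm]
  · simpa only [congruence_mul] using h3
  · intro j hj hjm
    rw [map_mul, h5 j hjm, h₀.track_lt j hj hjm]
  · intro j hj hjm
    obtain rfl : j = m := le_antisymm hjm hj
    rw [map_mul, map_atShift_of_congruence h₀.unitary h6, h₀.track_ge j le_rfl le_rfl]

theorem steps_up_list (hm : m = (n - 1) / 2)
    (hσ : ∀ k, 1 ≤ k → k ≤ n - 1 → ¬ IsEigenvalue A B (pole A B k)) {μ : OnePoint ℂ}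
    (hμ : ¬ IsEigenvalue A B μ) {t : ℕ} (htm : t + 1 ≤ m) :
    Steps A B ((List.range' 2 t).map Move.II) (State S A B ρ m 1 μ)
      (State S A B ρ m (t + 1) μ) := by
  induction t with
  | zero => exact Steps.nil
  | succ t ih =>
    rw [List.range'_1_concat, List.map_append]
    refine (ih (by omega)).append ?_
    rw [Nat.add_comm 2 t]
    exact steps_up hm hσ hμ (by omega) (by omega)

theorem steps_down_list (hm : m = (n - 1) / 2)
    (hσ : ∀ k, 1 ≤ k → k ≤ n - 1 → ¬ IsEigenvalue A B (pole A B k)) {μ : OnePoint ℂ}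
    (hμ : ¬ IsEigenvalue A B μ) {t : ℕ} (htm : t + 1 ≤ m) :
    Steps A B ((List.range' 2 t).map Move.II).reverse (State S A B ρ m (t + 1) μ)
      (State S A B ρ m 1 μ) := by
  induction t with
  | zero => exact Steps.nil
  | succ t ih =>
    rw [List.range'_1_concat, List.map_append, List.reverse_append]
    refine Steps.append ?_ (ih (by omega))
    rw [Nat.add_comm 2 t]
    exact steps_down hm hσ hμ (by omega) (by omega)

/-- The iteration up to its last move. -/
theorem steps_all_but_last (hn : 3 ≤ n) (h : Regular S A B) (hρ : ρ ≠ S.companion ρ)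
    (hρe : ¬ IsEigenvalue A B ρ)
    (hσ : ∀ k, 1 ≤ k → k ≤ n - 1 → ¬ IsEigenvalue A B (pole A B k)) :
    Steps A B ([Move.I ρ] ++ (List.range' 2 ((n - 1) / 2 - 1)).map Move.II ++ [middleMove n] ++
        ((List.range' 2 ((n - 1) / 2 - 1)).map Move.II).reverse) (· = 1)
      (State S A B ρ ((n - 1) / 2) 1 (S.companion ρ)) := by
  have hm : (n - 1) / 2 - 1 + 1 = (n - 1) / 2 := by omega
  have h1 := steps_up_list (S := S) (ρ := ρ) rfl hσ hρe hm.le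
  have h2 := steps_down_list (S := S) (ρ := ρ) rfl hσ (h.holds.not_isEigenvalue_companion hρe) hm.le
  rw [hm] at h1 h2
  exact (((steps_insert hn rfl h hσ).append h1).append (steps_middle hn rfl hρ hρe)).append h2

end Iteration

/-! ### Duality: from the small subspaces to the large ones. -/

section Subspaces

variable {n : ℕ} {S : Kind} {A B : Matrix (Fin n) (Fin n) ℂ}

theorem star_dotProduct_eq_zero {k l : ℕ} (hkl : k + l ≤ n) {y w : Fin n → ℂ}
    (hy : y ∈ stdSpan n k) (hw : w ∈ botSpan n l) : star y ⬝ᵥ w = 0 := by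
  rw [mem_stdSpan] at hy
  rw [mem_botSpan] at hw
  refine Finset.sum_eq_zero fun i _ => ?_
  by_cases hi : (i : ℕ) < k
  · rw [hw i (by omega), mul_zero]
  · rw [Pi.star_apply, hy i (by omega), star_zero, zero_mul]

/-- The Cayley-type transformation `(A - ρ̃ B)⁻¹ (A - ρ B)` is conformal for all the forms
`A - λ B`. -/
theorem Kind.Holds.cayley_conformal (h : S.Holds A B) {ρ : OnePoint ℂ} (hρ : ρ ≠ S.companion ρ)
    (hρe : ¬ IsEigenvalue A B ρ) :
    ∃ c : ℂ, ∀ p, ((atShift A B (S.companion ρ))⁻¹ * atShift A B ρ)ᴴ * atShift A B p *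
      ((atShift A B (S.companion ρ))⁻¹ * atShift A B ρ) = c • atShift A B p := by
  obtain ⟨c, hc, hcp⟩ := h.conjTranspose_atShift ρ
  have hN := h.not_isEigenvalue_companion hρe
  set M := atShift A B ρ with hM
  set N := atShift A B (S.companion ρ) with hNdef
  have hMu : IsUnit M.det := isUnit_iff_ne_zero.2 hρe
  have hNu : IsUnit N.det := isUnit_iff_ne_zero.2 hN
  have hNH : Nᴴ = (star c)⁻¹ • M := by
    have h1 := congrArg Matrix.conjTranspose hcp
    rw [conjTranspose_conjTranspose, conjTranspose_smul] at h1
    rw [h1, smul_smul, inv_mul_cancel₀ (star_ne_zero.2 hc), one_smul]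
  have hNHinv : (N⁻¹)ᴴ = star c • M⁻¹ := by
    rw [conjTranspose_nonsing_inv, hNH]
    refine inv_eq_left_inv ?_
    rw [smul_mul_smul_comm, nonsing_inv_mul _ hMu, mul_inv_cancel₀ (star_ne_zero.2 hc), one_smul]
  refine ⟨c * star c, fun p => ?_⟩
  -- X N⁻¹ M = M N⁻¹ X is evident for X = M and X = N, and these span the pencil. Together with M* =
  -- cN and N* proportional to M, it makes the product C*XC collapse to |c|² X.
  have hcomm : atShift A B p * (N⁻¹ * M) = M * N⁻¹ * atShift A B p := by
    obtain ⟨a, b, hab⟩ := exists_eq_add_smul_atShift A B hρ p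
    rw [← hM, ← hNdef] at hab
    rw [hab]
    simp only [add_mul, mul_add, smul_mul_assoc, mul_smul_comm]
    congr 2
    · rw [Matrix.mul_assoc]
    · rw [← Matrix.mul_assoc, mul_nonsing_inv _ hNu, Matrix.mul_assoc, nonsing_inv_mul _ hNu,
        Matrix.one_mul, Matrix.mul_one]
  rw [Matrix.mul_assoc, hcomm, conjTranspose_mul, hcp, hNHinv]
  calc c • N * star c • M⁻¹ * (M * N⁻¹ * atShift A B p)
      = (c * star c) • (N * (M⁻¹ * M) * N⁻¹ * atShift A B p) := by
        simp only [smul_mul_assoc, mul_smul_comm, smul_smul, Matrix.mul_assoc, mul_comm]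
    _ = (c * star c) • atShift A B p := by
        rw [nonsing_inv_mul _ hMu, Matrix.mul_one, mul_nonsing_inv _ hNu, Matrix.one_mul]

theorem star_mulVec_dotProduct (M : Matrix (Fin n) (Fin n) ℂ) (x y : Fin n → ℂ) :
    star (M *ᵥ x) ⬝ᵥ y = star x ⬝ᵥ (Mᴴ *ᵥ y) := by
  rw [star_mulVec, ← dotProduct_mulVec]

/-- The new form evaluated at Q*Cy and u is the old form at Cy and Cu', which is c times its value
at y and u'. -/
theorem orthogonal_of_conformal {C Q M : Matrix (Fin n) (Fin n) ℂ} {c : ℂ}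
    (hC : Cᴴ * M * C = c • M) (hQ : Q ∈ unitaryGroup (Fin n) ℂ) {y u u' : Fin n → ℂ}
    (hu : Q *ᵥ u = C *ᵥ u') (hy : star y ⬝ᵥ (M *ᵥ u') = 0) :
    star (Qᴴ *ᵥ (C *ᵥ y)) ⬝ᵥ ((Qᴴ * M * Q) *ᵥ u) = 0 := by
  rw [star_mulVec_dotProduct, conjTranspose_conjTranspose, mulVec_mulVec, ← Matrix.mul_assoc,
    ← Matrix.mul_assoc, unitary_mul_conjTranspose hQ, Matrix.one_mul, ← mulVec_mulVec, hu,
    star_mulVec_dotProduct, mulVec_mulVec, mulVec_mulVec, hC, smul_mulVec,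
    dotProduct_smul, hy, smul_zero]

/-- The form at p = σ_j maps E_j onto F_j, which kills the last j coordinates of z. One more
coordinate is needed: a shift q ≠ σ_j has a nonzero pole entry in column j, with zeros above it. -/
theorem Regular.mem_stdSpan_of_orthogonal (h : Regular S A B) {j k : ℕ} (hj : 1 ≤ j)
    (hk : k + j + 1 = n) (hp : ¬ IsEigenvalue A B (pole A B j)) {z : Fin n → ℂ}
    (hz : ∀ p, ∀ u ∈ stdSpan n j, star z ⬝ᵥ (atShift A B p *ᵥ u) = 0) : z ∈ stdSpan n k := by
  have hlow : ∀ i : Fin n, k + 1 ≤ (i : ℕ) → z i = 0 := by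
    intro i hi
    have hmem : (Pi.single i 1 : Fin n → ℂ) ∈ botSpan n j := by
      intro i' hi'
      exact Pi.single_eq_of_ne (fun h => by subst h; omega) _
    rw [← map_stdSpan_pole h.left h.right hj (by omega) hp] at hmem
    obtain ⟨u, hu, hu'⟩ := hmem
    have := hz (pole A B j) u hu
    rw [mulVecLin_apply] at hu'
    rw [hu', dotProduct_single, mul_one, Pi.star_apply] at this
    exact star_eq_zero.1 this
  rw [mem_stdSpan]
  intro i hi
  by_cases hik : k + 1 ≤ (i : ℕ)
  · exact hlow i hik
  obtain ⟨l, hl⟩ : ∃ l : Fin n, (l : ℕ) + 1 = j := ⟨⟨j - 1, by omega⟩, by simp; omega⟩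
  have hil : (i : ℕ) + l + 2 = n := by omega
  obtain ⟨q, hq⟩ := exists_ne (pole A B j)
  have hx : atShift A B q i l ≠ 0 := fun h0 => hq (by
    rw [← hl]
    exact ((h.pole_eq_iff hil).2 h0).symm)
  have h1 := hz q _ (single_mem_stdSpan (j := l) (by omega))
  rw [mulVec_single_one, dotProduct, Finset.sum_eq_single i] at h1
  · exact star_eq_zero.1 ((mul_eq_zero.1 h1).resolve_right hx)
  · intro i' _ hi'
    by_cases hlt : (i' : ℕ) < i
    · have : (atShift A B q).col l i' = 0 := h.left.atShift h.right q i' l (by omega)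
      rw [this, mul_zero]
    · have : (i' : ℕ) ≠ i := fun h => hi' (Fin.ext h)
      rw [Pi.star_apply, hlow i' (by omega), star_zero, zero_mul]
  · simp

end Subspaces

end PoleSwap

/-! ### Assembly of the theorem. -/

theorem theorem1 (n : ℕ) (hn : 3 ≤ n) (S : Kind) (A B : Matrix (Fin n) (Fin n) ℂ)
    (hS : S.Holds A B) (hA : IsAntiHessenberg A) (hB : IsAntiHessenberg B)
    (hAB : IsProper A B) (ρ : OnePoint ℂ) (hρ : ρ ≠ S.companion ρ)
    (hρ_eig : ¬ IsEigenvalue A B ρ)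
    (hσ_eig : ∀ k : ℕ, 1 ≤ k → k ≤ n - 1 → ¬ IsEigenvalue A B (pole A B k))
    (τ : OnePoint ℂ) :
    (∃ Q : Matrix (Fin n) (Fin n) ℂ, Run (basicIteration n ρ τ) A B Q) ∧
    ∀ Q : Matrix (Fin n) (Fin n) ℂ, Run (basicIteration n ρ τ) A B Q →
      Q ∈ Matrix.unitaryGroup (Fin n) ℂ ∧
      S.Holds (Qᴴ * A * Q) (Qᴴ * B * Q) ∧
      IsAntiHessenberg (Qᴴ * A * Q) ∧ IsAntiHessenberg (Qᴴ * B * Q) ∧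
      IsUnit (atShift A B (S.companion ρ)) ∧
      (∀ k : ℕ, 1 ≤ k → k ≤ n - 1 → (k = n - 1 → τ = pole A B 1) →
        colSpan Q k =
          (stdSpan n k).map
            (((atShift A B (S.companion ρ))⁻¹ * atShift A B ρ).mulVecLin)) ∧
      (∀ k : ℕ, 1 ≤ k → k ≤ n - 1 →
        (colSpan Q k).map (Qᴴ).mulVecLin = stdSpan n k) := by
  have hreg : Regular S A B := ⟨hS, hA, hB, hAB⟩
  obtain ⟨hex, hall⟩ := steps_all_but_last hn hreg hρ hρ_eig hσ_eig 1 rfl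
  simp only [congruence_one, Matrix.one_mul] at hex hall
  have hN : ¬ IsEigenvalue A B (S.companion ρ) := hS.not_isEigenvalue_companion hρ_eig
  -- Just before the last move the poles in positions up to m are ρ̃ followed by the original σ_2,
  -- …, σ_m, none of them an eigenvalue.
  have hpole : ∀ {Q₀}, State S A B ρ ((n - 1) / 2) 1 (S.companion ρ) Q₀ → ∀ j, 1 ≤ j →
      j ≤ (n - 1) / 2 → ¬ IsEigenvalue (congruence Q₀ A) (congruence Q₀ B)
        (pole (congruence Q₀ A) (congruence Q₀ B) j) := by
    intro Q₀ h₀ j hj hjm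
    rw [isEigenvalue_congruence h₀.unitary]
    by_cases hj1 : j = 1
    · rw [hj1, h₀.pole_eq]
      exact hN
    · rw [h₀.pole_gt j (by omega) hjm]
      exact hσ_eig j hj (by omega)
  constructor
  · obtain ⟨Q₀, hQ₀⟩ := hex
    have h₀ := hall Q₀ hQ₀
    obtain ⟨Q₁, hQ₁⟩ := exists_moveI hn h₀.regular (hpole h₀ 1 le_rfl (by omega)) τ
    exact ⟨Q₀ * Q₁, run_append.2 ⟨Q₀, Q₁, hQ₀, ⟨Q₁, 1, hQ₁, rfl, (Matrix.mul_one _).symm⟩, rfl⟩⟩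
  intro Q hQ
  obtain ⟨Q₀, Q₁', hQ₀, ⟨Q₁, _, hQ₁, rfl, rfl⟩, rfl⟩ := run_append.1 hQ
  rw [Matrix.mul_one]
  have h₀ := hall Q₀ hQ₀
  obtain ⟨hreg₁, -, -, hfix⟩ := IsMoveI.spec hn h₀.regular (hpole h₀ 1 le_rfl (by omega)) hQ₁
  have hu : Q₀ * Q₁ ∈ unitaryGroup (Fin n) ℂ := mul_mem h₀.unitary hQ₁.1.1
  rw [← congruence_mul, ← congruence_mul] at hreg₁
  refine ⟨hu, hreg₁.holds, hreg₁.left, hreg₁.right,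
    (isUnit_iff_isUnit_det _).2 (isUnit_iff_ne_zero.2 hN), ?_, ?_⟩
  swap
  · intro k _ _
    rw [colSpan_eq, ← map_mul, unitary_conjTranspose_mul hu, map_one]
  obtain ⟨c, hc⟩ := hS.cayley_conformal hρ hρ_eig
  set C := (atShift A B (S.companion ρ))⁻¹ * atShift A B ρ with hCdef
  have hNu : IsUnit (atShift A B (S.companion ρ)).det := isUnit_iff_ne_zero.2 hN
  have hCdet : C.det ≠ 0 := by
    rw [hCdef, det_mul]
    exact mul_ne_zero (isUnit_nonsing_inv_det _ hNu).ne_zero hρ_eig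
  have hlow : ∀ j, 1 ≤ j → j ≤ (n - 1) / 2 →
      (stdSpan n j).map Q₀.mulVecLin = (stdSpan n j).map C.mulVecLin := by
    intro j hj hjm
    refine map_cancel hN ?_
    rw [h₀.track_ge j hj hjm, ← map_mul, hCdef, ← Matrix.mul_assoc, mul_nonsing_inv _ hNu,
      Matrix.one_mul]
  have hmem : ∀ R : Matrix (Fin n) (Fin n) ℂ, R ∈ unitaryGroup (Fin n) ℂ → ∀ k,
      (∀ y ∈ stdSpan n k, Rᴴ *ᵥ (C *ᵥ y) ∈ stdSpan n k) →
      (stdSpan n k).map R.mulVecLin = (stdSpan n k).map C.mulVecLin := by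
    intro R hR k hk
    refine (map_stdSpan_eq_of_le hCdet (unitary_det_ne_zero hR) ?_).symm
    rintro _ ⟨y, hy, rfl⟩
    refine ⟨_, hk y hy, ?_⟩
    rw [mulVecLin_apply, mulVecLin_apply, mulVec_mulVec, unitary_mul_conjTranspose hR, one_mulVec]
  intro k hk hkn hτ
  rw [colSpan_eq]
  by_cases hk2 : k + 2 ≤ n
  -- The last move acts on the last two coordinates only, so it leaves Q E_k alone for k ≤ n-2.
  · rw [map_mul, hfix k hk2]
    by_cases hkm : k ≤ (n - 1) / 2
    · exact hlow k hk hkm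
    · obtain ⟨j, hj⟩ : ∃ j, k + j + 1 = n := ⟨n - 1 - k, by omega⟩
      refine hmem _ h₀.unitary k fun y hy => ?_
      refine h₀.regular.mem_stdSpan_of_orthogonal (j := j) (by omega) hj
        (hpole h₀ j (by omega) (by omega)) fun p u hu' => ?_
      have h1 : Q₀ *ᵥ u ∈ (stdSpan n j).map C.mulVecLin := by
        rw [← hlow j (by omega) (by omega)]
        exact Submodule.mem_map_of_mem hu'
      obtain ⟨u', hu'', hCu⟩ := h1
      rw [congruence_atShift]
      refine orthogonal_of_conformal (hc p) h₀.unitary hCu.symm ?_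
      exact star_dotProduct_eq_zero (l := j + 1) (by omega) hy
        (isAntiHessenberg_iff.1 (hA.atShift hB p) j (Submodule.mem_map_of_mem hu''))
  · obtain rfl : k = n - 1 := by omega
    have hτ' := hτ rfl
    refine hmem _ hu _ fun y hy => ?_
    -- The last move makes the first column of the final form at τ equal to γ e_n. Since τ = σ_1,
    -- the old form maps e_1 into the span of e_n as well, and orthogonality to γ e_n kills the last
    -- coordinate.
    obtain ⟨γ, hγ, hcol⟩ := hQ₁.2
    let e : Fin n := ⟨0, by omega⟩
    have h1 : (Q₀ * Q₁) *ᵥ Pi.single e 1 ∈ (stdSpan n 1).map C.mulVecLin := by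
      rw [← hlow 1 le_rfl (by omega), ← hfix 1 (by omega), ← map_mul]
      exact Submodule.mem_map_of_mem (single_mem_stdSpan (j := e) one_pos)
    obtain ⟨u', hu', hCu⟩ := h1
    have h2 := orthogonal_of_conformal (hc τ) hu hCu.symm (y := y) (by
      refine star_dotProduct_eq_zero (l := 1) (by omega) hy ?_
      rw [hτ', ← map_stdSpan_pole hA hB le_rfl (by omega) (hσ_eig 1 le_rfl (by omega))]
      exact Submodule.mem_map_of_mem hu')
    have h3 : ∀ i, ((Q₀ * Q₁)ᴴ * atShift A B τ * (Q₀ * Q₁)) i e =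
        if (i : ℕ) + 1 = n then γ else 0 := by
      intro i
      rw [← hcol i e rfl, congruence_atShift, conjTranspose_mul,
        ← mul_apply_of_col_one (Z := Q₁ᴴ * (Q₀ᴴ * atShift A B τ * Q₀)) (W := Q₁)
          (hQ₁.1.apply_col (by simp only [e]; omega))]
      simp only [Matrix.mul_assoc]
    rw [mem_stdSpan]
    intro i hi
    rw [mulVec_single_one, dotProduct, Finset.sum_eq_single i] at h2
    · rw [col_apply, h3, if_pos (by omega)] at h2
      exact star_eq_zero.1 ((mul_eq_zero.1 h2).resolve_right hγ)
    · intro i' _ hi'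
      have : (i' : ℕ) ≠ i := fun h => hi' (Fin.ext h)
      rw [col_apply, h3, if_neg (by omega), mul_zero]
    · simp
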